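/- Let $n,m,k,l$ be integers with $0\le m,k,l\le n$ and $k-l,\ m-l,\ n-m-k+l\ge 0$, and put $M:=m-l$, $N:=n-m-k+l$. On $(\mathbb C^2)^{\otimes n}$, $\mathbb C^2=\mathbb C|0\rangle\oplus\mathbb C|1\rangle$, with its standard Hermitian form, let the symmetric group $\mathfrak S_n$ act by $\pi(g)|i_1\cdots i_n\rangle=|i_{g^{-1}(1)}\cdots i_{g^{-1}(n)}\rangle$, and for $0\le x\le\lfloor n/2\rfloor$ let $\mathsf P_{(n-x,x)}$ be the orthogonal projector onto the isotypical component of the irreducible $\mathfrak S_n$-representation corresponding to the partition $(n-x,x)$. Let $$|\Xi_{n,m|k,l}\rangle:=|1^l0^{k-l}\rangle\otimes\binom{N+M}{M}^{-1/2}\sum_{w}|w\rangle\in(\mathbb C^2)^{\otimes n},$$ where $w$ runs over all words of length $N+M=n-k$ in $0,1$ with exactly $M$ letters $1$, and let $p(x):=\langle\Xi_{n,m|k,l}|\mathsf P_{(n-x,x)}|\Xi_{n,m|k,l}\rangle$. Write $(a)_i:=a(a+1)\cdots(a+i-1)$ and $${}_rF_s\!\left[{a_1,\dots,a_r\atop b_1,\dots,b_s};z\right]:=\sum_{i\ge0}\frac{(a_1)_i\cdots(a_r)_i}{i!\,(b_1)_i\cdots(b_s)_i}z^i,$$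 where a series with a numerator parameter that is a non-positive integer terminates: it is summed only up to the last $i$ for which the numerator does not vanish. Assume $m\le n-m$ and $0\le x\le m$. Then all the series below are well-defined terminating series, that is, none of their denominators vanishes in the range of summation, and $$p(x)=\binom{n-k}{m-l}\,\frac{\binom nx}{\binom nm}\,\frac{n-2x+1}{n-x+1}\;{}_4F_3\!\left[{-x,\;x-n-1,\;-M,\;-N\atop -m,\;m-n,\;-M-N};1\right].$$ The ${}_4F_3$-series here is the value $R_x(\lambda(M);-m-1,-n+m-1,-n+k-1,0)$ of the Racah polynomial $$R_d(\lambda(z);\alpha,\beta,\gamma,\delta):={}_4F_3\!\left[{-d,\;d+\alpha+\beta+1,\;-z,\;z+\gamma+\delta+1\atop \alpha+1,\;\beta+\delta+1,\;\gamma+1};1\right],\qquad \lambda(z)=z(z+\gamma+\delta+1).$$ Moreover the following (equivalent) hypergeometric identity holds: $$\sum_{i=0}^{\min(M,N)}\binom Mi\binom Ni\;{}_3F_2\!\left[{-i,\;-x,\;x-n-1\atop -m,\;m-n};1\right]=\binom{n-k}{m-l}\;{}_4F_3\!\left[{-x,\;x-n-1,\;-M,\;-N\atop -m,\;m-n,\;-M-N};1\right].$$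 -/

import Mathlib

open scoped Nat

noncomputable section

namespace RacahPmf

/-! ### Qubits and the permutation action -/

/-- The `n`-fold tensor power of `ℂ² = ℂ|0⟩ ⊕ ℂ|1⟩` with its standard Hermitian form, in coordinates
with respect to the orthonormal computational basis `|i₁ … iₙ⟩`, which is indexed by the words
`i : Fin n → Fin 2`. -/
abbrev Qubits (n : ℕ) : Type := EuclideanSpace ℂ (Fin n → Fin 2)

/-- The computational basis vector `|i₁ … iₙ⟩`. -/
def ket {n : ℕ} (i : Fin n → Fin 2) : Qubits n := EuclideanSpace.single i 1

/-- The representation `π` of the symmetric group by permutation of the tensor factors. It is written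
here on coordinates; on basis vectors it reads `π(g)|i₁ … iₙ⟩ = |i_{g⁻¹(1)} … i_{g⁻¹(n)}⟩`,
see `permRep_ket`. -/
def permRep (n : ℕ) : Representation ℂ (Equiv.Perm (Fin n)) (Qubits n) where
  toFun g :=
    { toFun := fun f => WithLp.toLp 2 fun i => f (i ∘ g)
      map_add' := fun _ _ => rfl
      map_smul' := fun _ _ => rfl }
  map_one' := rfl
  map_mul' _ _ := rfl

theorem permRep_apply {n : ℕ} (g : Equiv.Perm (Fin n)) (f : Qubits n) (i : Fin n → Fin 2) :
    permRep n g f i = f (i ∘ g) := rfl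

theorem permRep_ket {n : ℕ} (g : Equiv.Perm (Fin n)) (i : Fin n → Fin 2) :
    permRep n g (ket i) = ket (i ∘ ⇑g⁻¹) := by
  ext j
  have h : j ∘ ⇑g = i ↔ j = i ∘ ⇑g⁻¹ := by
    constructor
    · rintro rfl; ext t; simp
    · rintro rfl; ext t; simp
  rw [permRep_apply]
  simp only [ket, PiLp.single_apply, h]

/-! ### The irreducible representations of the symmetric group and isotypical components -/

/-- The Young symmetrizer of a Young tableau whose boxes are labelled by `Fin n`, where the box `i`
lies in the row `row i` and in the column `col i`: the signed sum of the column group times the sum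
of the row group. -/
def youngSymmetrizer {n : ℕ} (row col : Fin n → ℕ) : MonoidAlgebra ℂ (Equiv.Perm (Fin n)) :=
  (∑ q : Equiv.Perm (Fin n) with ∀ i, col (q i) = col i,
      MonoidAlgebra.single q ((Equiv.Perm.sign q : ℤ) : ℂ)) *
    ∑ p : Equiv.Perm (Fin n) with ∀ i, row (p i) = row i, MonoidAlgebra.single p (1 : ℂ)

/-- The irreducible representation (Specht module) of the symmetric group for the partition
`(n - x, x)`, `2 * x ≤ n`, as the left ideal of the group algebra generated by the Young symmetrizer
of the tableau with first row `0, …, n - x - 1` and second row `n - x, …, n - 1`. -/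
def twoRowSpecht (n x : ℕ) :
    Submodule (MonoidAlgebra ℂ (Equiv.Perm (Fin n))) (MonoidAlgebra ℂ (Equiv.Perm (Fin n))) :=
  Submodule.span _ {youngSymmetrizer
    (fun i : Fin n => if (i : ℕ) < n - x then 0 else 1)
    (fun i : Fin n => if (i : ℕ) < n - x then (i : ℕ) else (i : ℕ) - (n - x))}

/-- The isotypical component of `(ℂ²)^{⊗n}` for the partition `(n - x, x)`: the sum of all
subrepresentations that are isomorphic to the irreducible representation of that partition. -/
def isotypic (n x : ℕ) : Submodule ℂ (Qubits n) :=
  ((isotypicComponent (MonoidAlgebra ℂ (Equiv.Perm (Fin n))) (permRep n).asModule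
    (twoRowSpecht n x)).restrictScalars ℂ).map (permRep n).asModuleEquiv.toLinearMap

/-- The orthogonal projector `P_{(n-x,x)}` of `(ℂ²)^{⊗n}` onto the isotypical component. -/
def isotypicProj (n x : ℕ) : Qubits n →L[ℂ] Qubits n := (isotypic n x).starProjection

/-! ### The vector `Ξ_{n,m|k,l}` and the probability mass function -/

/-- The tensor product of `u ∈ (ℂ²)^{⊗a}` and `v ∈ (ℂ²)^{⊗b}` in `(ℂ²)^{⊗n}`, `a + b = n`. -/
def tensor {a b n : ℕ} (h : a + b = n) (u : Qubits a) (v : Qubits b) : Qubits n :=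
  WithLp.toLp 2 fun i =>
    u (fun s => i (Fin.cast h (Fin.castAdd b s))) * v (fun t => i (Fin.cast h (Fin.natAdd a t)))

theorem tensor_ket {a b : ℕ} (i : Fin a → Fin 2) (j : Fin b → Fin 2) :
    tensor rfl (ket i) (ket j) = ket (Fin.append i j) := by
  ext s
  have h : s = Fin.append i j ↔
      (fun t => s (Fin.castAdd b t)) = i ∧ (fun t => s (Fin.natAdd a t)) = j := by
    constructor
    · rintro rfl; constructor <;> ext t <;> simp
    · rintro ⟨rfl, rfl⟩
      ext t
      refine Fin.addCases (fun t => ?_) (fun t => ?_) t <;> simp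
  by_cases h1 : (fun t => s (Fin.castAdd b t)) = i <;>
    by_cases h2 : (fun t => s (Fin.natAdd a t)) = j <;>
      simp [tensor, ket, h, h1, h2]

/-- The basis vector `|1^l 0^{k-l}⟩` of `(ℂ²)^{⊗k}`. -/
def onesZeros (k l : ℕ) : Qubits k := ket fun i => if (i : ℕ) < l then 1 else 0

/-- The Dicke state `Ξ_{a,b}`: the normalized sum of all basis vectors of `(ℂ²)^{⊗a}` with exactly
`b` letters `1`. -/
def dicke (a b : ℕ) : Qubits a :=
  (((Real.sqrt (a.choose b))⁻¹ : ℝ) : ℂ) •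
    ∑ i : Fin a → Fin 2 with (Finset.univ.filter fun t => i t = 1).card = b, ket i

/-- The range of the parameters:
`m, k, l ≤ n`, and `k - l`, `m - l`, `n - m - k + l` are non-negative. -/
structure Admissible (n m k l : ℕ) : Prop where
  m_le : m ≤ n
  k_le : k ≤ n
  l_le_m : l ≤ m
  l_le_k : l ≤ k
  add_le : m + k ≤ n + l

/-- The vector `Ξ_{n,m|k,l} = |1^l 0^{k-l}⟩ ⊗ Ξ_{n-k,m-l}`. -/
def Xi {n m k l : ℕ} (h : Admissible n m k l) : Qubits n :=
  tensor (Nat.add_sub_of_le h.k_le) (onesZeros k l) (dicke (n - k) (m - l))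

/-- The probability mass function `p(x) = ⟨Ξ_{n,m|k,l}| P_{(n-x,x)} |Ξ_{n,m|k,l}⟩`. -/
def pmf {n m k l : ℕ} (h : Admissible n m k l) (x : ℕ) : ℂ :=
  inner ℂ (Xi h) (isotypicProj n x (Xi h))

/-! ### Hypergeometric series -/

/-- The product `(a₁, …, a_r)_i` of the raising factorials `(a)_i = a (a + 1) ⋯ (a + i - 1)`. -/
def risingProd (a : List ℂ) (i : ℕ) : ℂ := (a.map fun c => (ascPochhammer ℂ i).eval c).prod

/-- The generalized hypergeometric series
`∑_{i ≥ 0} (a₁, …, a_r)_i / (1, b₁, …, b_s)_i * z ^ i`. -/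
def hypergeometric (a b : List ℂ) (z : ℂ) : ℂ :=
  ∑' i : ℕ, risingProd a i / risingProd (1 :: b) i * z ^ i

/-- The hypergeometric series with these parameters is a well-defined terminating series: up to some
index no denominator vanishes, and beyond it all numerators vanish. In this case `hypergeometric` is
the finite sum up to that index (the remaining terms are zero, whatever their denominators). -/
def Terminating (a b : List ℂ) : Prop :=
  ∃ d : ℕ, (∀ i ≤ d, risingProd (1 :: b) i ≠ 0) ∧ ∀ i, d < i → risingProd a i = 0

theorem hypergeometric_eq_sum {a b : List ℂ} {d : ℕ} (h : ∀ i, d < i → risingProd a i = 0) (z : ℂ) :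
    hypergeometric a b z =
      ∑ i ∈ Finset.range (d + 1), risingProd a i / risingProd (1 :: b) i * z ^ i :=
  tsum_eq_sum fun i hi => by simp [h i (by simpa [Nat.lt_succ_iff] using hi)]

/-- The Racah polynomial `R_d(λ(z); α, β, γ, δ)`, `λ(z) = z (z + γ + δ + 1)`, as a function of `z`. -/
def racah (d : ℕ) (z α β γ δ : ℂ) : ℂ :=
  hypergeometric [-(d : ℂ), d + α + β + 1, -z, z + γ + δ + 1] [α + 1, β + δ + 1, γ + 1] 1

end RacahPmf

end

open RacahPmf

/-!
The matrix entries of the isotypical projector `P = P_{(n-x,x)}` between words with `m` letters `1`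
are computed first; the vector `Ξ` is a normalized sum of such words, so that `p(x)` is a sum of
these entries.

Words with `m` letters `1` are identified with the sets of the places of these letters. As `P`
commutes with the symmetric group, its entry at `(A, B)` is a function `κ` of `#(A \ B)` alone
(`exists_projEntry_eq`). The central element `∑ (s t)` of the group algebra acts on the Specht module
by a scalar, the content sum of the partition, because the Young symmetrizer annihilates
transpositions of boxes in different rows and columns (`swapSum_mul_symmetrizer`). Hence it acts by
that scalar on the isotypical component, and for `κ` this is a three-term recurrence
(`sum_swap_distance`). It is the difference equation of the Hahn polynomial
`₃F₂(-i, -x, x-n-1; -m, m-n; 1)` (`hahn_recurrence`), so `κ` is a multiple of it.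

The constant comes from one vector that `P` fixes: the product of the singlets `|01⟩ - |10⟩` on the
columns of height two with the sum of all words with `m - x` letters `1` on the other places. For
`m = x` it is the word `0 ⋯ 0 1 ⋯ 1` antisymmetrized over the columns, which generates a copy of the
Specht module; the raising operator of `sl₂` commutes with the symmetric group, is injective on this
copy by the commutation relation, and carries the vector to the ones with larger `m`
(`singletVec_mem_isotypic`). Evaluated at one coordinate, the fixed point equation collapses to a
single term, by antisymmetry, and gives the constant (`projEntry_eq`).

Summing the Hahn polynomial over the words in `Ξ`, by double counting, gives the
`₄F₃`-series (`pmf_eq_sum`, `choose_mul_hypergeometric_four_three`); the hypergeometric identity is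
the Vandermonde convolution (`sum_choose_mul_hahn`).
-/

open RacahPmf

namespace RacahPmf

open Finset

/-! ### Hahn polynomials and terminating series -/

theorem ascPochhammer_eval_neg_natCast (a i : ℕ) :
    (ascPochhammer ℂ i).eval (-(a : ℂ)) = (-1) ^ i * (a.descFactorial i : ℂ) := by
  rw [ascPochhammer_eval_neg_eq_descPochhammer, descPochhammer_eval_eq_descFactorial]

theorem ascPochhammer_eval_neg_natCast_ne_zero {a i : ℕ} (h : i ≤ a) :
    (ascPochhammer ℂ i).eval (-(a : ℂ)) ≠ 0 := by
  rw [ascPochhammer_eval_neg_natCast]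
  have : a.descFactorial i ≠ 0 := by
    rw [Ne, Nat.descFactorial_eq_zero_iff_lt]; omega
  simp [this]

theorem ascPochhammer_eval_neg_natCast_eq_zero {a i : ℕ} (h : a < i) :
    (ascPochhammer ℂ i).eval (-(a : ℂ)) = 0 := by
  rw [ascPochhammer_eval_neg_natCast, Nat.descFactorial_eq_zero_iff_lt.2 h]; simp

theorem ascPochhammer_eval_one_complex (i : ℕ) : (ascPochhammer ℂ i).eval 1 = (i ! : ℂ) :=
  ascPochhammer_eval_one ℂ i

/-- The coefficient `(-x)_t (x-n-1)_t / ((-m)_t (m-n)_t)` shared by the `₃F₂` and the `₄F₃`. -/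
noncomputable def hahnCoeff (n m x t : ℕ) : ℂ :=
  (ascPochhammer ℂ t).eval (-(x : ℂ)) * (ascPochhammer ℂ t).eval ((x : ℂ) - n - 1) /
    ((ascPochhammer ℂ t).eval (-(m : ℂ)) * (ascPochhammer ℂ t).eval ((m : ℂ) - n))

/-- The value at `i` of the polynomial `₃F₂(-i, -x, x-n-1; -m, m-n; 1)`, expanded in binomials. -/
noncomputable def hahn (n m x i : ℕ) : ℂ :=
  ∑ t ∈ range (x + 1), (-1) ^ t * (i.choose t : ℂ) * hahnCoeff n m x t

theorem hahn_zero (n m x : ℕ) : hahn n m x 0 = 1 := by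
  rw [hahn, sum_range_succ']
  simp [hahnCoeff]

theorem hahnCoeff_succ {n m x t : ℕ} (ht : t < m) (hmn : m ≤ n - m) :
    hahnCoeff n m x (t + 1) * (((m : ℂ) - t) * ((n : ℂ) - m - t)) =
      hahnCoeff n m x t * (((x : ℂ) - t) * ((n : ℂ) + 1 - x - t)) := by
  have e : (m : ℂ) - n = -((n - m : ℕ) : ℂ) := by
    rw [Nat.cast_sub (by omega)]; ring
  have h1 := ascPochhammer_eval_neg_natCast_ne_zero (a := m) (i := t) (by omega)
  have h2 := ascPochhammer_eval_neg_natCast_ne_zero (a := n - m) (i := t) (by omega)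
  have h3 := ascPochhammer_eval_neg_natCast_ne_zero (a := m) (i := t + 1) (by omega)
  have h4 := ascPochhammer_eval_neg_natCast_ne_zero (a := n - m) (i := t + 1) (by omega)
  rw [← e] at h2 h4
  unfold hahnCoeff
  rw [ascPochhammer_succ_eval] at h3 h4
  have h5 := right_ne_zero_of_mul h3
  have h6 := right_ne_zero_of_mul h4
  simp only [ascPochhammer_succ_eval]
  field_simp
  ring

/-- The binomial identity behind the difference equation of the Hahn polynomials. -/
theorem choose_difference (n m x i u : ℕ) :
    ((m : ℂ) - i) * ((n : ℂ) - m - i) * (i.choose u : ℂ) - i * ((u + 1 : ℕ) * (i.choose (u + 1) : ℂ))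
      + x * ((n : ℂ) - x + 1) * (i.choose (u + 1) : ℂ) =
    ((m : ℂ) - u) * ((n : ℂ) - m - u) * (i.choose u : ℂ) +
      ((x : ℂ) - (u + 1 : ℕ)) * ((n : ℂ) + 1 - x - (u + 1 : ℕ)) * (i.choose (u + 1) : ℂ) := by
  have h : (i.choose (u + 1) : ℂ) * (u + 1) = i.choose u * ((i : ℂ) - u) := by
    rcases le_or_gt u i with hu | hu
    · have := Nat.choose_succ_right_eq i u
      rw [← Nat.cast_sub hu]
      exact_mod_cast this
    · rw [Nat.choose_eq_zero_of_lt hu, Nat.choose_eq_zero_of_lt (by omega : i < u + 1)]; simp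
  push_cast
  linear_combination (-(i : ℂ) - u + n) * h

/-- The three-term recurrence (difference equation) of the Hahn polynomials. -/
theorem hahn_recurrence {n m x : ℕ} (i : ℕ) (hx : x ≤ m) (hmn : m ≤ n - m) :
    ((m : ℂ) - i) * ((n : ℂ) - m - i) * (hahn n m x (i + 1) - hahn n m x i) +
      (i : ℂ) ^ 2 * (hahn n m x (i - 1) - hahn n m x i) =
      -(x * ((n : ℂ) - x + 1)) * hahn n m x i := by
  have up : hahn n m x (i + 1) - hahn n m x i =
      ∑ t ∈ range x, (-1) ^ (t + 1) * (i.choose t : ℂ) * hahnCoeff n m x (t + 1) := by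
    rw [hahn, hahn, ← sum_sub_distrib, sum_range_succ']
    simp only [Nat.choose_succ_succ, Nat.choose_zero_right, sub_self, add_zero]
    refine sum_congr rfl fun t _ => ?_
    push_cast; ring
  have down : (i : ℂ) ^ 2 * (hahn n m x (i - 1) - hahn n m x i) =
      ∑ t ∈ range x, -((-1) ^ (t + 1) * (i * ((t + 1 : ℕ) * (i.choose (t + 1) : ℂ))) *
        hahnCoeff n m x (t + 1)) := by
    rcases i with _ | i
    · simp
    rw [hahn, hahn, ← sum_sub_distrib, sum_range_succ']
    simp only [Nat.choose_succ_succ, Nat.choose_zero_right, sub_self, add_zero, mul_sum,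
      Nat.add_sub_cancel]
    refine sum_congr rfl fun t _ => ?_
    have := Nat.add_one_mul_choose_eq i t
    rw [Nat.choose_succ_succ] at this
    have h : ((i : ℂ) + 1) * i.choose t = (i.choose t + i.choose (t + 1)) * (t + 1) := by
      exact_mod_cast this
    push_cast
    linear_combination (-1 : ℂ) ^ (t + 1) * hahnCoeff n m x (t + 1) * (-((i : ℂ) + 1)) * h
  have base : hahn n m x i = 1 +
      ∑ t ∈ range x, (-1) ^ (t + 1) * (i.choose (t + 1) : ℂ) * hahnCoeff n m x (t + 1) := by
    rw [hahn, sum_range_succ', add_comm]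
    simp [hahnCoeff]
  -- after summation the two halves of `choose_difference` telescope
  have tele : ∀ y ≤ x, ∑ t ∈ range y, (-1) ^ (t + 1) * hahnCoeff n m x (t + 1) *
      (((m : ℂ) - t) * ((n : ℂ) - m - t) * (i.choose t : ℂ) +
        ((x : ℂ) - (t + 1 : ℕ)) * ((n : ℂ) + 1 - x - (t + 1 : ℕ)) * (i.choose (t + 1) : ℂ)) =
      (-1) ^ y * hahnCoeff n m x y * (((x : ℂ) - y) * ((n : ℂ) + 1 - x - y)) * i.choose y
        - x * ((n : ℂ) - x + 1) := by
    intro y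
    induction y with
    | zero => intro _; simp [hahnCoeff]; ring
    | succ y ih =>
      intro hy
      rw [sum_range_succ, ih (by omega)]
      have := hahnCoeff_succ (n := n) (m := m) (x := x) (t := y) (by omega) hmn
      push_cast
      linear_combination (-(-1 : ℂ) ^ y * i.choose y) * this
  have key := tele x le_rfl
  rw [sub_self, zero_mul, mul_zero, zero_mul, zero_sub] at key
  rw [down, up]
  have : (∑ t ∈ range x, (-1) ^ (t + 1) * hahnCoeff n m x (t + 1) *
      (((m : ℂ) - i) * ((n : ℂ) - m - i) * (i.choose t : ℂ) - i * ((t + 1 : ℕ) * (i.choose (t + 1) : ℂ))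
      + x * ((n : ℂ) - x + 1) * (i.choose (t + 1) : ℂ))) = - (x * ((n : ℂ) - x + 1)) := by
    rw [← key]
    exact sum_congr rfl fun t _ => by rw [choose_difference]
  rw [base]
  have split : ((m : ℂ) - i) * ((n : ℂ) - m - i) *
        ∑ t ∈ range x, (-1) ^ (t + 1) * (i.choose t : ℂ) * hahnCoeff n m x (t + 1) +
      ∑ t ∈ range x, -((-1) ^ (t + 1) * (i * ((t + 1 : ℕ) * (i.choose (t + 1) : ℂ))) *
        hahnCoeff n m x (t + 1)) +
      x * ((n : ℂ) - x + 1) *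
        ∑ t ∈ range x, (-1) ^ (t + 1) * (i.choose (t + 1) : ℂ) * hahnCoeff n m x (t + 1) =
      -(x * ((n : ℂ) - x + 1)) := by
    rw [← this, mul_sum, mul_sum, ← sum_add_distrib, ← sum_add_distrib]
    exact sum_congr rfl fun t _ => by ring
  linear_combination split

/-- A numerator parameter `-c` ends the series at the index `c`. -/
theorem risingProd_eq_zero {a : List ℂ} {c : ℕ} (h : -(c : ℂ) ∈ a) {i : ℕ} (hi : c < i) :
    risingProd a i = 0 := by
  rw [risingProd, List.prod_eq_zero_iff, List.mem_map]
  exact ⟨_, h, ascPochhammer_eval_neg_natCast_eq_zero hi⟩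

theorem hypergeometric_three_two {n m x : ℕ} (i : ℕ) :
    hypergeometric [-(i : ℂ), -(x : ℂ), x - n - 1] [-(m : ℂ), m - n] 1 = hahn n m x i := by
  rw [hypergeometric_eq_sum (d := x) fun j hj => risingProd_eq_zero (by simp) hj, hahn]
  refine sum_congr rfl fun t _ => ?_
  simp only [risingProd, List.map_cons, List.map_nil, List.prod_cons, List.prod_nil, mul_one,
    one_pow, ascPochhammer_eval_neg_natCast i, Nat.descFactorial_eq_factorial_mul_choose,
    ascPochhammer_eval_one_complex, hahnCoeff]
  have := Nat.factorial_ne_zero t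
  push_cast
  field_simp

/-- Both sides are `(M + N)!` over `M! (N - j)!`. -/
theorem choose_mul_descFactorial (M N j : ℕ) (h : j ≤ N) :
    (M + N).choose M * N.descFactorial j = (M + N - j).choose M * (M + N).descFactorial j := by
  have h1 := Nat.add_choose_mul_factorial_mul_factorial M N
  have h2 := Nat.add_choose_mul_factorial_mul_factorial M (N - j)
  rw [← Nat.choose_symm_add] at h1 h2
  have h3 := Nat.factorial_mul_descFactorial h
  have h4 := Nat.factorial_mul_descFactorial (show j ≤ M + N by omega)
  rw [← Nat.add_sub_assoc h] at h2
  have p1 := Nat.factorial_pos M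
  have p2 := Nat.factorial_pos (N - j)
  apply Nat.eq_of_mul_eq_mul_left (Nat.mul_pos p1 p2)
  calc M ! * (N - j)! * ((M + N).choose M * N.descFactorial j)
      = (M + N).choose M * M ! * ((N - j)! * N.descFactorial j) := by ring
    _ = (M + N - j).choose M * M ! * (N - j)! * (M + N).descFactorial j := by
        rw [h3, h1, h2, h4]
    _ = _ := by ring

/-- The binomial coefficient clears the denominators `(-M-N)_t` of the `₄F₃`-series. -/
theorem choose_mul_hypergeometric_four_three (n m x M N : ℕ) :
    ((M + N).choose M : ℂ) * hypergeometric [-(x : ℂ), x - n - 1, -(M : ℂ), -(N : ℂ)]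
      [-(m : ℂ), m - n, -(M : ℂ) - N] 1 =
    ∑ t ∈ range (x + 1), (-1) ^ t * hahnCoeff n m x t *
      ((M.choose t : ℂ) * ((M + N - t).choose M : ℂ)) := by
  rw [hypergeometric_eq_sum (d := x) fun j hj => risingProd_eq_zero (by simp) hj, mul_sum]
  refine sum_congr rfl fun t _ => ?_
  have e : -(M : ℂ) - N = -((M + N : ℕ) : ℂ) := by push_cast; ring
  rw [e]
  simp only [risingProd, List.map_cons, List.map_nil, List.prod_cons, List.prod_nil, mul_one,
    one_pow, ascPochhammer_eval_neg_natCast M, ascPochhammer_eval_neg_natCast N,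
    ascPochhammer_eval_neg_natCast (M + N),
    ascPochhammer_eval_one_complex, hahnCoeff]
  rcases le_or_gt t N with hN | hN
  · have h := congrArg (Nat.cast : ℕ → ℂ) (choose_mul_descFactorial M N t hN)
    have h0 : ((M + N).descFactorial t : ℂ) ≠ 0 := by
      rw [Nat.cast_ne_zero, Ne, Nat.descFactorial_eq_zero_iff_lt]; omega
    have h1 : (t ! : ℂ) ≠ 0 := by exact_mod_cast Nat.factorial_ne_zero t
    rw [Nat.descFactorial_eq_factorial_mul_choose M]
    push_cast at h ⊢
    have h2 : ((-1 : ℂ) ^ t) * (-1) ^ t = 1 := by rw [← mul_pow]; simp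
    rw [show ((M + N - t).choose M : ℂ) = (M + N).choose M * N.descFactorial t /
      (M + N).descFactorial t by rw [h, mul_div_cancel_right₀ _ h0]]
    have h3 : ((-1 : ℂ) ^ t) ≠ 0 := by simp
    field_simp
  · rw [Nat.descFactorial_eq_zero_iff_lt.2 hN]
    rcases le_or_gt t M with hM | hM
    · rw [Nat.choose_eq_zero_of_lt (by omega : M + N - t < M)]; simp
    · rw [Nat.choose_eq_zero_of_lt hM]; simp

/-- Vandermonde's identity, weighted by `i.choose t`. -/
theorem sum_choose_mul_choose_mul_choose (M N t : ℕ) :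
    ∑ i ∈ range (min M N + 1), M.choose i * N.choose i * i.choose t =
      M.choose t * (M + N - t).choose M := by
  rcases le_or_gt t M with h | h
  · have ext : ∑ i ∈ range (min M N + 1), M.choose i * N.choose i * i.choose t =
        ∑ i ∈ range (M + 1), M.choose i * N.choose i * i.choose t := by
      refine sum_subset (by intro i; simp; omega) fun i hi hi' => ?_
      simp only [mem_range] at hi hi'
      rw [Nat.choose_eq_zero_of_lt (by omega : N < i)]; simp
    rw [ext, show M + N - t = N + (M - t) by omega, Nat.add_choose_eq,
      Nat.sum_antidiagonal_eq_sum_range_succ_mk, mul_sum]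
    refine sum_congr rfl fun i hi => ?_
    simp only [mem_range] at hi
    rcases le_or_gt t i with hti | hti
    · have := Nat.choose_mul (n := M) (k := i) (s := t) hti
      have s := Nat.choose_symm (n := M - t) (k := i - t) (by omega)
      rw [show M - t - (i - t) = M - i by omega] at s
      dsimp only
      rw [s, mul_right_comm, this]; ring
    · rw [Nat.choose_eq_zero_of_lt hti, Nat.choose_eq_zero_of_lt (by omega : M - t < M - i)]; simp
  · rw [Nat.choose_eq_zero_of_lt h, zero_mul]
    refine sum_eq_zero fun i hi => ?_
    simp only [mem_range] at hi
    rw [Nat.choose_eq_zero_of_lt (by omega : i < t), mul_zero]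

theorem sum_choose_mul_hahn (n m x M N : ℕ) :
    ∑ i ∈ range (min M N + 1), (M.choose i : ℂ) * (N.choose i : ℂ) * hahn n m x i =
    ∑ t ∈ range (x + 1), (-1) ^ t * hahnCoeff n m x t *
      ((M.choose t : ℂ) * ((M + N - t).choose M : ℂ)) := by
  simp only [hahn, mul_sum]
  rw [sum_comm]
  refine sum_congr rfl fun t _ => ?_
  have := congrArg (Nat.cast : ℕ → ℂ) (sum_choose_mul_choose_mul_choose M N t)
  push_cast at this
  rw [← this, mul_sum]
  exact sum_congr rfl fun i _ => by ring

theorem terminating_three_two {n m x : ℕ} (i : ℕ) (hx : x ≤ m) (hmn : m ≤ n - m) :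
    Terminating [-(i : ℂ), -(x : ℂ), x - n - 1] [-(m : ℂ), m - n] := by
  refine ⟨x, fun t ht => ?_, fun j hj => risingProd_eq_zero (by simp) hj⟩
  rw [show (m : ℂ) - n = -((n - m : ℕ) : ℂ) by rw [Nat.cast_sub (by omega)]; ring]
  simp only [risingProd, List.map_cons, List.map_nil, List.prod_cons, List.prod_nil, mul_one,
    ascPochhammer_eval_one_complex]
  exact mul_ne_zero (by exact_mod_cast Nat.factorial_ne_zero t)
    (mul_ne_zero (ascPochhammer_eval_neg_natCast_ne_zero (by omega))
      (ascPochhammer_eval_neg_natCast_ne_zero (by omega)))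

theorem terminating_four_three {n m x : ℕ} (M N : ℕ) (hx : x ≤ m) (hmn : m ≤ n - m) :
    Terminating [-(x : ℂ), x - n - 1, -(M : ℂ), -(N : ℂ)] [-(m : ℂ), m - n, -(M : ℂ) - N] := by
  refine ⟨min x M, fun t ht => ?_, fun j hj => ?_⟩
  · rw [show (m : ℂ) - n = -((n - m : ℕ) : ℂ) by rw [Nat.cast_sub (by omega)]; ring,
      show -(M : ℂ) - N = -((M + N : ℕ) : ℂ) by push_cast; ring]
    simp only [risingProd, List.map_cons, List.map_nil, List.prod_cons, List.prod_nil, mul_one,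
      ascPochhammer_eval_one_complex]
    exact mul_ne_zero (by exact_mod_cast Nat.factorial_ne_zero t)
      (mul_ne_zero (ascPochhammer_eval_neg_natCast_ne_zero (by omega))
        (mul_ne_zero (ascPochhammer_eval_neg_natCast_ne_zero (by omega))
          (ascPochhammer_eval_neg_natCast_ne_zero (by omega))))
  · rcases le_total x M with h | h
    · exact risingProd_eq_zero (c := x) (by simp) (by omega)
    · exact risingProd_eq_zero (c := M) (by simp) (by omega)

/-- The constant of normalization: `1 / (h_x * C(n-2x, m-x))` is the dimension of the Specht module
divided by `C(n, m)`. -/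
theorem hahnCoeff_self_mul {n m x : ℕ} (hx : x ≤ m) (hmn : m ≤ n - m) :
    hahnCoeff n m x x * ((n - 2 * x).choose (m - x) : ℂ) *
      (((n.choose x : ℂ) / (n.choose m : ℂ)) * (((n : ℂ) - 2 * x + 1) / ((n : ℂ) - x + 1))) = 1 := by
  have hmn' : m ≤ n := by omega
  rw [hahnCoeff, show (m : ℂ) - n = -((n - m : ℕ) : ℂ) by rw [Nat.cast_sub (by omega)]; ring,
    show (x : ℂ) - n - 1 = -((n + 1 - x : ℕ) : ℂ) by rw [Nat.cast_sub (by omega)]; push_cast; ring]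
  simp only [ascPochhammer_eval_neg_natCast]
  have d1 := Nat.factorial_mul_descFactorial (le_refl x)
  have d2 := Nat.factorial_mul_descFactorial (show x ≤ n + 1 - x by omega)
  have d3 := Nat.factorial_mul_descFactorial (show x ≤ m by omega)
  have d4 := Nat.factorial_mul_descFactorial (show x ≤ n - m by omega)
  have c1 := Nat.choose_mul_factorial_mul_factorial (show m - x ≤ n - 2 * x by omega)
  have c2 := Nat.choose_mul_factorial_mul_factorial (show x ≤ n by omega)
  have c3 := Nat.choose_mul_factorial_mul_factorial (show m ≤ n by omega)
  rw [show n - 2 * x - (m - x) = n - m - x by omega] at c1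
  rw [show n + 1 - x - x = n - 2 * x + 1 by omega, show n + 1 - x = n - x + 1 by omega,
    Nat.factorial_succ, Nat.factorial_succ] at d2
  rw [show n + 1 - x = n - x + 1 by omega]
  simp only [Nat.sub_self, Nat.factorial_zero, one_mul] at d1
  have e1 : (n : ℂ) - 2 * x + 1 = ((n - 2 * x + 1 : ℕ) : ℂ) := by
    rw [Nat.cast_add, Nat.cast_sub (by omega)]; push_cast; ring
  have e2 : (n : ℂ) - x + 1 = ((n - x + 1 : ℕ) : ℂ) := by
    rw [Nat.cast_add, Nat.cast_sub (by omega)]; push_cast; ring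
  rw [e1, e2, d1]
  have key : x ! * (n - x + 1).descFactorial x * (n - 2 * x).choose (m - x) * n.choose x *
      (n - 2 * x + 1) =
      m.descFactorial x * (n - m).descFactorial x * n.choose m * (n - x + 1) := by
    have p : 0 < (n - 2 * x)! * (m - x)! * (n - m - x)! * (n - x)! := by positivity
    apply Nat.eq_of_mul_eq_mul_left p
    calc _ = ((n - 2 * x + 1) * (n - 2 * x)! * (n - x + 1).descFactorial x) *
          ((n - 2 * x).choose (m - x) * (m - x)! * (n - m - x)!) *
          (n.choose x * x ! * (n - x)!) := by ring
      _ = ((n - x + 1) * (n - x)!) * (n - 2 * x)! * (n.choose m * m ! * (n - m)!) := by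
          rw [d2, c1, c2, c3]
      _ = _ := by rw [← d3, ← d4]; ring
  have key' := congrArg (Nat.cast : ℕ → ℂ) key
  have n1 : ((n.choose m : ℕ) : ℂ) ≠ 0 := by
    exact_mod_cast (Nat.choose_pos hmn').ne'
  have n2 : ((n - x + 1 : ℕ) : ℂ) ≠ 0 := Nat.cast_ne_zero.2 (Nat.succ_ne_zero _)
  have n3 : ((m.descFactorial x : ℕ) : ℂ) ≠ 0 := by
    rw [Nat.cast_ne_zero, Ne, Nat.descFactorial_eq_zero_iff_lt]; omega
  have n4 : (((n - m).descFactorial x : ℕ) : ℂ) ≠ 0 := by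
    rw [Nat.cast_ne_zero, Ne, Nat.descFactorial_eq_zero_iff_lt]; omega
  have n5 : ((-1 : ℂ) ^ x) ≠ 0 := by simp
  simp only [Nat.cast_mul] at key'
  field_simp
  linear_combination key'

/-! ### Words and sets -/

/-- The word whose letters `1` stand at the places in `B`. -/
def indWord {n : ℕ} (B : Finset (Fin n)) : Fin n → Fin 2 := fun s => if s ∈ B then 1 else 0

theorem indWord_eq_one {n : ℕ} {B : Finset (Fin n)} {s : Fin n} : indWord B s = 1 ↔ s ∈ B := by
  unfold indWord; split_ifs with h <;> simp [h]

/-- Words in `0, 1` correspond to the sets of the places of their letters `1`. -/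
def wordEquiv (n : ℕ) : Finset (Fin n) ≃ (Fin n → Fin 2) where
  toFun := indWord
  invFun w := univ.filter fun s => w s = 1
  left_inv B := by ext s; simp [indWord_eq_one]
  right_inv w := by
    ext s
    by_cases h : w s = 1
    · simp [indWord, h]
    · have : w s = 0 := by omega
      simp [indWord, this]

theorem indWord_injective {n : ℕ} : Function.Injective (indWord (n := n)) :=
  (wordEquiv n).injective

theorem indWord_comp {n : ℕ} (B : Finset (Fin n)) (g : Equiv.Perm (Fin n)) :
    indWord B ∘ ⇑g = indWord (B.map (g⁻¹).toEmbedding) := by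
  ext s
  have : (s ∈ B.map (g⁻¹).toEmbedding) ↔ g s ∈ B := mem_map_equiv
  simp only [indWord, Function.comp, this]

theorem permRep_indWord {n : ℕ} (g : Equiv.Perm (Fin n)) (f : Qubits n) (B : Finset (Fin n)) :
    permRep n g f (indWord B) = f (indWord (B.map (g⁻¹).toEmbedding)) := by
  rw [permRep_apply, indWord_comp]

theorem permRep_ket_indWord {n : ℕ} (g : Equiv.Perm (Fin n)) (B : Finset (Fin n)) :
    permRep n g (ket (indWord B)) = ket (indWord (B.map g.toEmbedding)) := by
  rw [permRep_ket, indWord_comp, inv_inv]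

theorem qubits_ext {n : ℕ} {f g : Qubits n} (h : ∀ B, f (indWord B) = g (indWord B)) : f = g := by
  ext w
  obtain ⟨B, rfl⟩ := (wordEquiv n).surjective w
  exact h B

/-! ### The isotypical projector commutes with the symmetric group -/

theorem inner_permRep {n : ℕ} (g : Equiv.Perm (Fin n)) (u v : Qubits n) :
    inner ℂ (permRep n g u) (permRep n g v) = inner ℂ u v := by
  simp only [PiLp.inner_apply, permRep_apply]
  exact (Equiv.arrowCongr g.symm (Equiv.refl (Fin 2))).sum_comp fun i => inner ℂ (u i) (v i)

theorem permRep_inv_apply {n : ℕ} (g : Equiv.Perm (Fin n)) (v : Qubits n) :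
    permRep n g (permRep n g⁻¹ v) = v := by
  rw [← Module.End.mul_apply, ← map_mul, mul_inv_cancel, map_one, Module.End.one_apply]

theorem mem_isotypic {n x : ℕ} {v : Qubits n} :
    v ∈ isotypic n x ↔ (permRep n).asModuleEquiv.symm v ∈
      isotypicComponent (MonoidAlgebra ℂ (Equiv.Perm (Fin n))) (permRep n).asModule
        (twoRowSpecht n x) := by
  rw [isotypic, Submodule.mem_map]
  constructor
  · rintro ⟨y, hy, rfl⟩; simpa using hy
  · intro h; exact ⟨_, h, by simp⟩

theorem permRep_mem_isotypic {n x : ℕ} (g : Equiv.Perm (Fin n)) {v : Qubits n}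
    (hv : v ∈ isotypic n x) : permRep n g v ∈ isotypic n x := by
  rw [mem_isotypic, Representation.asModuleEquiv_symm_map_rho]
  exact Submodule.smul_mem _ _ (mem_isotypic.1 hv)

theorem isotypicProj_permRep {n x : ℕ} (g : Equiv.Perm (Fin n)) (v : Qubits n) :
    isotypicProj n x (permRep n g v) = permRep n g (isotypicProj n x v) := by
  refine Submodule.eq_starProjection_of_mem_of_inner_eq_zero
    (permRep_mem_isotypic g (Submodule.starProjection_apply_mem _ _)) fun w hw => ?_
  have h := Submodule.starProjection_inner_eq_zero (K := isotypic n x) v _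
    (permRep_mem_isotypic g⁻¹ hw)
  rw [← inner_permRep g, map_sub, permRep_inv_apply] at h
  exact h

/-- The matrix entries of the isotypical projector with respect to the basis vectors indexed by the
sets of places of the letters `1`. -/
noncomputable def projEntry (n x : ℕ) (A B : Finset (Fin n)) : ℂ :=
  isotypicProj n x (ket (indWord B)) (indWord A)

theorem projEntry_map {n x : ℕ} (g : Equiv.Perm (Fin n)) (A B : Finset (Fin n)) :
    projEntry n x (A.map g.toEmbedding) (B.map g.toEmbedding) = projEntry n x A B := by
  rw [projEntry, ← permRep_ket_indWord, isotypicProj_permRep, permRep_indWord, projEntry]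
  have h : (A.map g.toEmbedding).map (g⁻¹).toEmbedding = A := by
    ext s
    rw [mem_map_equiv, mem_map_equiv]
    exact iff_of_eq (congrArg (· ∈ A) (g.symm_apply_apply s))
  rw [h]

theorem ket_apply {n : ℕ} (A B : Finset (Fin n)) :
    (ket (indWord B) : Qubits n) (indWord A) = if A = B then 1 else 0 := by
  simp [ket, indWord_injective.eq_iff]

theorem inner_ket {n : ℕ} (w : Fin n → Fin 2) (v : Qubits n) : inner ℂ (ket w) v = v w := by
  rw [ket, EuclideanSpace.inner_single_left]; simp

/-- Two pairs of sets are conjugate under permutations if their sizes and the sizes of their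
differences agree. -/
theorem exists_perm_map_eq {α : Type*} [Fintype α] [DecidableEq α] {A B A' B' : Finset α}
    (hA : #A = #A') (hB : #B = #B') (h : #(A \ B) = #(A' \ B')) :
    ∃ g : Equiv.Perm α, A.map g.toEmbedding = A' ∧ B.map g.toEmbedding = B' := by
  let f : Finset α → Finset α → α → Bool × Bool := fun A B s => (decide (s ∈ A), decide (s ∈ B))
  have i1 := card_sdiff_add_card_inter A B
  have i2 := card_sdiff_add_card_inter A' B'
  have i3 := card_sdiff_add_card_inter B A
  have i4 := card_sdiff_add_card_inter B' A'
  have i5 := card_union_add_card_inter A B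
  have i6 := card_union_add_card_inter A' B'
  have i7 := card_compl (A ∪ B)
  have i8 := card_compl (A' ∪ B')
  rw [inter_comm] at i3 i4
  have key : ∀ c : Bool × Bool, Fintype.card {s // f A B s = c} = Fintype.card {s // f A' B' s = c} := by
    intro c
    rw [Fintype.card_subtype, Fintype.card_subtype]
    have e : ∀ A B : Finset α, univ.filter (fun s => f A B s = c) =
      (match c with
        | (true, true) => A ∩ B
        | (true, false) => A \ B
        | (false, true) => B \ A
        | (false, false) => (A ∪ B)ᶜ) := by
      intro A B
      rcases c with ⟨_ | _, _ | _⟩ <;> (ext s; simp [f]; try tauto)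
    rw [e, e]
    rcases c with ⟨_ | _, _ | _⟩ <;> dsimp only <;> omega
  let g : Equiv.Perm α := Equiv.ofFiberEquiv (f := f A B) (g := f A' B')
    fun c => Fintype.equivOfCardEq (key c)
  have hg : ∀ s, f A' B' (g s) = f A B s := fun s => Equiv.ofFiberEquiv_map _ s
  have hA' : ∀ s, g s ∈ A' ↔ s ∈ A := fun s => by
    simpa [f] using congrArg Prod.fst (hg s)
  have hB' : ∀ s, g s ∈ B' ↔ s ∈ B := fun s => by
    simpa [f] using congrArg Prod.snd (hg s)
  refine ⟨g, ?_, ?_⟩ <;> ext s <;> rw [mem_map_equiv]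
  · rw [← hA', Equiv.apply_symm_apply]
  · rw [← hB', Equiv.apply_symm_apply]

/-- The matrix entries between sets of the same size depend only on the size of the difference. -/
theorem exists_projEntry_eq (n m x : ℕ) : ∃ κ : ℕ → ℂ, ∀ A B : Finset (Fin n),
    #A = m → #B = m → projEntry n x A B = κ #(A \ B) := by
  classical
  refine ⟨fun i => if h : ∃ p : Finset (Fin n) × Finset (Fin n),
      #p.1 = m ∧ #p.2 = m ∧ #(p.1 \ p.2) = i
    then projEntry n x h.choose.1 h.choose.2 else 0, fun A B hA hB => ?_⟩
  have h : ∃ p : Finset (Fin n) × Finset (Fin n),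
      #p.1 = m ∧ #p.2 = m ∧ #(p.1 \ p.2) = #(A \ B) := ⟨(A, B), hA, hB, rfl⟩
  dsimp only
  rw [dif_pos h]
  obtain ⟨h1, h2, h3⟩ := h.choose_spec
  obtain ⟨g, g1, g2⟩ := exists_perm_map_eq (hA.trans h1.symm) (hB.trans h2.symm) h3.symm
  rw [← projEntry_map g A B, g1, g2]

/-! ### The sum of all transpositions -/

/-- The sum of `(s t)` over all pairs `s, t`, including the `n` trivial ones with `s = t`, in the
group algebra. It is central. -/
noncomputable def swapSum (n : ℕ) : MonoidAlgebra ℂ (Equiv.Perm (Fin n)) :=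
  ∑ s : Fin n, ∑ t : Fin n, MonoidAlgebra.single (Equiv.swap s t) 1

theorem commute_swapSum {n : ℕ} (y : MonoidAlgebra ℂ (Equiv.Perm (Fin n))) :
    swapSum n * y = y * swapSum n := by
  induction y using MonoidAlgebra.induction_on with
  | of g =>
    simp only [swapSum, MonoidAlgebra.of_apply, sum_mul, mul_sum, MonoidAlgebra.single_mul_single,
      mul_one]
    rw [← Equiv.sum_comp g]
    refine sum_congr rfl fun s _ => ?_
    rw [← Equiv.sum_comp g]
    refine sum_congr rfl fun t _ => ?_
    rw [Equiv.mul_swap_eq_swap_mul]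
  | add a b ha hb => rw [mul_add, add_mul, ha, hb]
  | smul r a ha => rw [mul_smul_comm, smul_mul_assoc, ha]

section Symmetrizer

variable {n : ℕ} (row col : Fin n → ℕ)

/-- The signed sum of the column group. -/
noncomputable def colAntisym : MonoidAlgebra ℂ (Equiv.Perm (Fin n)) :=
  ∑ q : Equiv.Perm (Fin n) with ∀ i, col (q i) = col i,
    MonoidAlgebra.single q ((Equiv.Perm.sign q : ℤ) : ℂ)

/-- The sum of the row group. -/
noncomputable def rowSym : MonoidAlgebra ℂ (Equiv.Perm (Fin n)) :=
  ∑ p : Equiv.Perm (Fin n) with ∀ i, row (p i) = row i, MonoidAlgebra.single p (1 : ℂ)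

variable {row col}

theorem swap_preserves {s t : Fin n} (h : col s = col t) (i : Fin n) :
    col (Equiv.swap s t i) = col i := by
  rw [Equiv.swap_apply_def]; split_ifs with h1 h2
  · rw [h1, h]
  · rw [h2, h]
  · rfl

theorem single_swap_mul_rowSym {s t : Fin n} (h : row s = row t) :
    MonoidAlgebra.single (Equiv.swap s t) (1 : ℂ) * rowSym row = rowSym row := by
  rw [rowSym, mul_sum]
  refine sum_equiv (Equiv.mulLeft (Equiv.swap s t)) (fun p => ?_) fun p _ => ?_
  · simp [swap_preserves h]
  · simp [MonoidAlgebra.single_mul_single]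

theorem colAntisym_mul_single_swap {s t : Fin n} (h : col s = col t) (hst : s ≠ t) :
    colAntisym col * MonoidAlgebra.single (Equiv.swap s t) (1 : ℂ) = -colAntisym col := by
  rw [colAntisym, sum_mul, ← sum_neg_distrib]
  refine sum_equiv (Equiv.mulRight (Equiv.swap s t)) (fun q => ?_) fun q _ => ?_
  · simp only [mem_filter, mem_univ, true_and, Equiv.coe_mulRight, Equiv.Perm.mul_apply]
    constructor
    · intro hq i; rw [hq, swap_preserves h]
    · intro hq i
      have := hq (Equiv.swap s t i)
      rwa [Equiv.swap_apply_self, swap_preserves h] at this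
  · simp [MonoidAlgebra.single_mul_single, Equiv.Perm.sign_swap hst, MonoidAlgebra.single_neg]

theorem single_swap_mul_colAntisym {s t : Fin n} (h : col s = col t) (hst : s ≠ t) :
    MonoidAlgebra.single (Equiv.swap s t) (1 : ℂ) * colAntisym col = -colAntisym col := by
  rw [colAntisym, mul_sum, ← sum_neg_distrib]
  refine sum_equiv (Equiv.mulLeft (Equiv.swap s t)) (fun q => ?_) fun q _ => ?_
  · simp [swap_preserves h]
  · simp [MonoidAlgebra.single_mul_single, Equiv.Perm.sign_swap hst, MonoidAlgebra.single_neg]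

/-- If the box `u` lies in the row of `s` and the column of `t`, then the antisymmetry in `t, u` and
the symmetry in `s, u` cancel each other. -/
theorem colAntisym_mul_single_swap_mul_rowSym_eq_zero {s t u : Fin n} (hut : col u = col t)
    (hus : row u = row s) (h1 : u ≠ t) (h2 : u ≠ s) :
    colAntisym col * MonoidAlgebra.single (Equiv.swap s t) (1 : ℂ) * rowSym row = 0 := by
  have e : Equiv.swap u t * Equiv.swap s t = Equiv.swap s t * Equiv.swap u s := by
    rw [Equiv.mul_swap_eq_swap_mul (Equiv.swap s t), Equiv.swap_apply_left,
      Equiv.swap_apply_of_ne_of_ne h2 h1]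
  have h : colAntisym col * MonoidAlgebra.single (Equiv.swap s t) (1 : ℂ) * rowSym row =
      -(colAntisym col * MonoidAlgebra.single (Equiv.swap s t) (1 : ℂ) * rowSym row) := by
    -- insert `(u t)` on the left, move it through `(s t)`, absorb `(u s)` on the right
    calc _ = -(colAntisym col * (MonoidAlgebra.single (Equiv.swap u t) (1 : ℂ) *
          MonoidAlgebra.single (Equiv.swap s t) (1 : ℂ)) * rowSym row) := by
            rw [← mul_assoc, colAntisym_mul_single_swap hut h1, neg_mul, neg_mul, neg_neg]
      _ = -(colAntisym col * MonoidAlgebra.single (Equiv.swap s t) (1 : ℂ) *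
          (MonoidAlgebra.single (Equiv.swap u s) (1 : ℂ) * rowSym row)) := by
            rw [show MonoidAlgebra.single (Equiv.swap u t) (1 : ℂ) *
              MonoidAlgebra.single (Equiv.swap s t) (1 : ℂ) = MonoidAlgebra.single (Equiv.swap s t) 1 *
              MonoidAlgebra.single (Equiv.swap u s) 1 by
                rw [MonoidAlgebra.single_mul_single, MonoidAlgebra.single_mul_single, e]]
            simp only [mul_assoc]
      _ = _ := by rw [single_swap_mul_rowSym hus]
  have h' : (2 : ℂ) • (colAntisym col * MonoidAlgebra.single (Equiv.swap s t) (1 : ℂ) *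
      rowSym row) = 0 := by
    rw [two_smul]; nth_rw 1 [h]; exact neg_add_cancel _
  exact (smul_eq_zero.1 h').resolve_left two_ne_zero

end Symmetrizer

/-- The row of the box `i` in the tableau of `twoRowSpecht`. -/
def rowOf (n x : ℕ) (i : Fin n) : ℕ := if (i : ℕ) < n - x then 0 else 1

/-- The column of the box `i` in the tableau of `twoRowSpecht`. -/
def colOf (n x : ℕ) (i : Fin n) : ℕ := if (i : ℕ) < n - x then (i : ℕ) else (i : ℕ) - (n - x)

/-- Only pairs of boxes in the same row or in the same column contribute; this is the content sum
of the partition `(n - x, x)`. -/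
theorem swapSum_mul_symmetrizer {n x : ℕ} (hx : 2 * x ≤ n) :
    swapSum n * (colAntisym (colOf n x) * rowSym (rowOf n x)) =
      ((n : ℂ) ^ 2 - 2 * x * (n - x + 1)) • (colAntisym (colOf n x) * rowSym (rowOf n x)) := by
  set c := colAntisym (colOf n x) * rowSym (rowOf n x) with hc
  rw [hc, ← mul_assoc, commute_swapSum, swapSum, mul_sum, sum_mul]
  have term : ∀ s t : Fin n, colAntisym (colOf n x) * MonoidAlgebra.single (Equiv.swap s t) (1 : ℂ) *
      rowSym (rowOf n x) = (((if rowOf n x s = rowOf n x t then 1 else 0) -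
        (if (t : ℕ) = s + (n - x) ∨ (s : ℕ) = t + (n - x) then 1 else 0) : ℤ) : ℂ) • c := by
    intro s t
    by_cases hr : rowOf n x s = rowOf n x t
    · rw [mul_assoc, single_swap_mul_rowSym hr, if_pos hr, if_neg, ← hc]
      · simp
      · unfold rowOf at hr; split_ifs at hr <;> omega
    · have hst : s ≠ t := fun h => hr (by rw [h])
      rw [if_neg hr]
      split_ifs with hcol
      · rw [colAntisym_mul_single_swap _ hst, neg_mul, ← hc]
        · simp
        · unfold rowOf at hr; unfold colOf; split_ifs at hr ⊢ <;> omega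
      · simp only [sub_self, Int.cast_zero, zero_smul]
        -- the box above the one in the second row closes the rectangle
        wlog hlt : (s : ℕ) < n - x generalizing s t
        · rw [Equiv.swap_comm]
          exact this t s (fun h => hr h.symm) hst.symm (by tauto)
            (by unfold rowOf at hr; split_ifs at hr <;> omega)
        have ht : ¬ (t : ℕ) < n - x := by unfold rowOf at hr; split_ifs at hr <;> omega
        refine colAntisym_mul_single_swap_mul_rowSym_eq_zero (u := ⟨t - (n - x), by omega⟩)
          ?_ ?_ ?_ ?_
        · simp only [colOf]; split_ifs <;> omega
        · simp only [rowOf]; split_ifs <;> omega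
        · simp only [ne_eq, Fin.ext_iff]; omega
        · simp only [ne_eq, Fin.ext_iff]; omega
  simp only [mul_sum, sum_mul, term, ← sum_smul]
  congr 1
  obtain ⟨a, rfl⟩ : ∃ a, n = a + x := ⟨n - x, by omega⟩
  simp only [rowOf, ← Int.cast_sum, Nat.add_sub_cancel]
  have count : ∑ s ∈ range (a + x), ∑ t ∈ range (a + x),
      (((if (if s < a then 0 else 1) = (if t < a then 0 else 1) then 1 else 0) -
        (if t = s + a ∨ s = t + a then 1 else 0)) : ℤ) = (a : ℤ) ^ 2 + x ^ 2 - 2 * x := by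
    have lower : ∀ s ∈ range a, ∑ t ∈ range (a + x),
        (((if (if s < a then 0 else 1) = (if t < a then 0 else 1) then 1 else 0) -
          (if t = s + a ∨ s = t + a then 1 else 0)) : ℤ) = a - if s ∈ range x then 1 else 0 := by
      intro s hs
      rw [mem_range] at hs
      rw [sum_range_add, sum_congr rfl (g := fun _ => (1 : ℤ)), sum_congr (s₁ := range x) rfl
        (g := fun t => -if s = t then (1 : ℤ) else 0), sum_neg_distrib, sum_ite_eq]
      · simp [sub_eq_add_neg]
      · intro t ht
        rw [mem_range] at ht
        split_ifs <;> first | contradiction | omega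
      · intro t ht
        rw [mem_range] at ht
        rw [if_pos (by simp [hs, ht]), if_neg (by omega)]; rfl
    have upper : ∀ s ∈ range x, ∑ t ∈ range (a + x),
        (((if (if a + s < a then 0 else 1) = (if t < a then 0 else 1) then 1 else 0) -
          (if t = a + s + a ∨ a + s = t + a then 1 else 0)) : ℤ) = x - 1 := by
      intro s hs
      rw [mem_range] at hs
      rw [sum_range_add, sum_congr rfl (g := fun t => -if s = t then (1 : ℤ) else 0),
        sum_congr (s₁ := range x) rfl (g := fun _ => (1 : ℤ)), sum_neg_distrib, sum_ite_eq,
        if_pos (by simp; omega)]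
      · simp; ring
      · intro t ht
        rw [mem_range] at ht
        split_ifs <;> first | contradiction | omega
      · intro t ht
        rw [mem_range] at ht
        split_ifs <;> first | contradiction | omega
    rw [sum_range_add, sum_congr rfl lower, sum_congr rfl upper, sum_sub_distrib,
      ← sum_filter, filter_mem_eq_inter, inter_eq_right.2 (range_subset_range.2 (by omega))]
    simp
    ring
  have fin := fun s : ℕ => Fin.sum_univ_eq_sum_range (fun t : ℕ =>
    (((if (if s < a then 0 else 1) = (if t < a then 0 else 1) then 1 else 0) -
        (if t = s + a ∨ s = t + a then 1 else 0)) : ℤ)) (a + x)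
  simp only [fin]
  rw [Fin.sum_univ_eq_sum_range (fun s : ℕ => ∑ t ∈ range (a + x),
    (((if (if s < a then 0 else 1) = (if t < a then 0 else 1) then 1 else 0) -
        (if t = s + a ∨ s = t + a then 1 else 0)) : ℤ)) (a + x), count]
  push_cast
  ring

/-- The scalar by which the sum of transpositions acts passes from the Specht module to its isotypical
component. -/
theorem swapSum_smul_of_mem_isotypic {n x : ℕ} (hx : 2 * x ≤ n) {v : Qubits n}
    (hv : v ∈ isotypic n x) :
    ∑ s : Fin n, ∑ t : Fin n, permRep n (Equiv.swap s t) v =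
      ((n : ℂ) ^ 2 - 2 * x * (n - x + 1)) • v := by
  set c : ℂ := (n : ℂ) ^ 2 - 2 * x * (n - x + 1) with hc
  have key : ∀ w ∈ isotypicComponent (MonoidAlgebra ℂ (Equiv.Perm (Fin n))) (permRep n).asModule
        (twoRowSpecht n x), swapSum n • w = algebraMap ℂ (MonoidAlgebra ℂ (Equiv.Perm (Fin n))) c • w := by
    intro w hw
    rw [isotypicComponent, sSup_eq_iSup'] at hw
    induction hw using Submodule.iSup_induction' with
    | mem N w hw =>
      obtain ⟨N, ⟨e⟩⟩ := N
      have : swapSum n • (⟨w, hw⟩ : N) = algebraMap ℂ (MonoidAlgebra ℂ (Equiv.Perm (Fin n))) c • (⟨w, hw⟩ : N) := by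
        apply e.injective
        rw [map_smul, map_smul]
        obtain ⟨y, hy⟩ := e ⟨w, hw⟩
        obtain ⟨z, rfl⟩ := Submodule.mem_span_singleton.1 hy
        ext1
        change swapSum n * (z * (colAntisym (colOf n x) * rowSym (rowOf n x))) =
          algebraMap ℂ _ c * (z * (colAntisym (colOf n x) * rowSym (rowOf n x)))
        rw [← mul_assoc, commute_swapSum, mul_assoc, swapSum_mul_symmetrizer hx, ← Algebra.smul_def,
          mul_smul_comm]
      exact congrArg Subtype.val this
    | zero => simp
    | add y z _ _ hy hz => rw [smul_add, smul_add, hy, hz]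
  have := congrArg (permRep n).asModuleEquiv (key _ (mem_isotypic.1 hv))
  rw [← Representation.asModuleEquiv_symm_map_smul, LinearEquiv.apply_symm_apply,
    Representation.asModuleEquiv_map_smul, LinearEquiv.apply_symm_apply] at this
  rw [← this, swapSum]
  simp [map_sum, Representation.asAlgebraHom_single]

/-! ### The matrix entries of the isotypical projector are Hahn polynomials -/

theorem sum_projEntry_swap {n x : ℕ} (hx : 2 * x ≤ n) (A B : Finset (Fin n)) :
    ∑ s : Fin n, ∑ t : Fin n, projEntry n x A (B.map (Equiv.swap s t).toEmbedding) =
      ((n : ℂ) ^ 2 - 2 * x * (n - x + 1)) * projEntry n x A B := by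
  have h := swapSum_smul_of_mem_isotypic hx (v := isotypicProj n x (ket (indWord B)))
    (Submodule.starProjection_apply_mem _ _)
  have h' := congrArg (fun f : Qubits n => f (indWord A)) h
  simp only [← isotypicProj_permRep, permRep_ket_indWord] at h'
  simpa [projEntry] using h'

theorem map_swap_of_iff {α : Type*} [DecidableEq α] {B : Finset α} {s t : α}
    (h : s ∈ B ↔ t ∈ B) : B.map (Equiv.swap s t).toEmbedding = B := by
  ext a
  rw [mem_map_equiv, Equiv.symm_swap, Equiv.swap_apply_def]
  split_ifs with h1 h2
  · rw [h1, h]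
  · rw [h2, h]
  · rfl

theorem map_swap_of_mem_of_notMem {α : Type*} [DecidableEq α] {B : Finset α} {s t : α}
    (hs : s ∈ B) (ht : t ∉ B) : B.map (Equiv.swap s t).toEmbedding = insert t (B.erase s) := by
  ext a
  rw [mem_map_equiv, Equiv.symm_swap, Equiv.swap_apply_def, mem_insert, mem_erase]
  have : s ≠ t := fun h => ht (h ▸ hs)
  split_ifs with h1 h2
  · subst h1; simp [ht, this]
  · subst h2; simp [hs]
  · simp [h1, h2]

/-- The change of the distance to `A` when `s` is replaced by `t` in `B`. -/
theorem card_sdiff_swap {α : Type*} [DecidableEq α] {A B : Finset α} {s t : α}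
    (hs : s ∈ B) (ht : t ∉ B) : #(A \ insert t (B.erase s)) + (if t ∈ A then 1 else 0) =
      #(A \ B) + if s ∈ A then 1 else 0 := by
  have hst : s ≠ t := fun h => ht (h ▸ hs)
  by_cases hsA : s ∈ A <;> by_cases htA : t ∈ A
  · have e : insert t (A \ insert t (B.erase s)) = insert s (A \ B) := by
      ext a; by_cases h1 : a = s <;> by_cases h2 : a = t <;> simp_all
    have := congrArg card e
    rw [card_insert_of_notMem (by simp), card_insert_of_notMem (by simp [hs])] at this
    simpa [hsA, htA] using this
  · have e : A \ insert t (B.erase s) = insert s (A \ B) := by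
      ext a; by_cases h1 : a = s <;> by_cases h2 : a = t <;> simp_all
    rw [e, card_insert_of_notMem (by simp [hs])]
    simp [hsA, htA]
  · have e : insert t (A \ insert t (B.erase s)) = A \ B := by
      ext a; by_cases h1 : a = s <;> by_cases h2 : a = t <;> simp_all
    rw [← e, card_insert_of_notMem (by simp)]
    simp [hsA, htA]
  · have e : A \ insert t (B.erase s) = A \ B := by
      ext a; by_cases h1 : a = s <;> by_cases h2 : a = t <;> simp_all
    rw [e]
    simp [hsA, htA]

/-- The adjacency operator of the Johnson graph, applied to a function of the distance to `A`. -/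
theorem sum_swap_distance {n m : ℕ} (κ : ℕ → ℂ) {A B : Finset (Fin n)} (hA : #A = m)
    (hB : #B = m) :
    ∑ s : Fin n, ∑ t : Fin n, (κ #(A \ B.map (Equiv.swap s t).toEmbedding) - κ #(A \ B)) =
      2 * (((m : ℂ) - #(A \ B)) * ((n : ℂ) - m - #(A \ B)) * (κ (#(A \ B) + 1) - κ #(A \ B)) +
        (#(A \ B) : ℂ) ^ 2 * (κ (#(A \ B) - 1) - κ #(A \ B))) := by
  set i := #(A \ B) with hi
  set F : Fin n → Fin n → ℂ := fun s t =>
    κ #(A \ B.map (Equiv.swap s t).toEmbedding) - κ i with hF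
  have F0 : ∀ s t, (s ∈ B ↔ t ∈ B) → F s t = 0 := fun s t h => by
    simp only [hF, map_swap_of_iff h, hi, sub_self]
  have Fsymm : ∀ s t, F s t = F t s := fun s t => by simp only [hF, Equiv.swap_comm]
  have F1 : ∀ s ∈ B, ∀ t ∈ Bᶜ, F s t =
      ((if s ∈ A then 1 else 0) * (if t ∈ A then 0 else 1)) * (κ (i + 1) - κ i) +
      ((if s ∈ A then 0 else 1) * (if t ∈ A then 1 else 0)) * (κ (i - 1) - κ i) := by
    intro s hs t ht
    rw [mem_compl] at ht
    have h := card_sdiff_swap (A := A) hs ht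
    simp only [hF, map_swap_of_mem_of_notMem hs ht]
    rw [← hi] at h
    split_ifs at h ⊢ with h1 h2
    · rw [show #(A \ insert t (B.erase s)) = i by omega]; simp
    · rw [show #(A \ insert t (B.erase s)) = i + 1 by omega]; simp
    · rw [show #(A \ insert t (B.erase s)) = i - 1 by omega]; simp
    · rw [show #(A \ insert t (B.erase s)) = i by omega]; simp
  have half : ∑ s : Fin n, ∑ t : Fin n, F s t = 2 * ∑ s ∈ B, ∑ t ∈ Bᶜ, F s t := by
    have a1 : ∀ s ∈ B, ∑ t, F s t = ∑ t ∈ Bᶜ, F s t := fun s hs => by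
      rw [← sum_add_sum_compl B, sum_eq_zero fun t ht => F0 s t (by simp [hs, ht]), zero_add]
    have a2 : ∀ s ∈ Bᶜ, ∑ t, F s t = ∑ t ∈ B, F s t := fun s hs => by
      rw [mem_compl] at hs
      rw [← sum_add_sum_compl B, sum_eq_zero (s := Bᶜ) fun t ht =>
        F0 s t (by simp only [mem_compl] at ht; simp [hs, ht]), add_zero]
    rw [← sum_add_sum_compl B, sum_congr rfl a1, sum_congr rfl a2, sum_comm (s := Bᶜ), two_mul]
    congr 1
    exact sum_congr rfl fun s _ => sum_congr rfl fun t _ => Fsymm _ _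
  have i1 := card_sdiff_add_card_inter A B
  have i2 := card_sdiff_add_card_inter B A
  have i3 := card_union_add_card_inter A B
  have i4 := card_compl (A ∪ B)
  have i5 := card_le_univ (A ∪ B)
  rw [inter_comm] at i2
  rw [Fintype.card_fin] at i4 i5
  have c1 : ∑ s ∈ B, (if s ∈ A then (1 : ℂ) else 0) = (m : ℂ) - i := by
    rw [← sum_filter, filter_mem_eq_inter, sum_const, inter_comm, nsmul_one,
      show #(A ∩ B) = m - i by omega, Nat.cast_sub (by omega)]
  have c2 : ∑ s ∈ B, (if s ∈ A then (0 : ℂ) else 1) = i := by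
    rw [sum_ite, sum_const_zero, zero_add, sum_const, nsmul_one, filter_notMem_eq_sdiff,
      show #(B \ A) = i by omega]
  have c3 : ∑ t ∈ Bᶜ, (if t ∈ A then (1 : ℂ) else 0) = i := by
    rw [← sum_filter, filter_mem_eq_inter, sum_const, nsmul_one, inter_comm, ← sdiff_eq_inter_compl]
  have c4 : ∑ t ∈ Bᶜ, (if t ∈ A then (0 : ℂ) else 1) = (n : ℂ) - m - i := by
    rw [sum_ite, sum_const_zero, zero_add, sum_const, nsmul_one, filter_notMem_eq_sdiff,
      show Bᶜ \ A = (A ∪ B)ᶜ by ext; simp [and_comm], show #(A ∪ B)ᶜ = n - (m + i) by omega,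
      Nat.cast_sub (by omega)]
    push_cast; ring
  rw [half, sum_congr rfl fun s hs => sum_congr rfl (F1 s hs)]
  simp only [sum_add_distrib, ← sum_mul, ← sum_mul_sum, c1, c2, c3, c4]
  ring

theorem exists_pair_card_sdiff {n m i : ℕ} (hi : i ≤ m) (hmn : m ≤ n - m) :
    ∃ A B : Finset (Fin n), #A = m ∧ #B = m ∧ #(A \ B) = i := by
  obtain ⟨A, hA⟩ : ∃ A : Finset (Fin n), #A = m :=
    (exists_subset_card_eq (s := (univ : Finset (Fin n))) (n := m)
      (by rw [card_fin]; omega)).imp fun _ h => h.2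
  obtain ⟨C, hC, hC'⟩ := exists_subset_card_eq (s := A) (n := m - i) (by omega)
  obtain ⟨D, hD, hD'⟩ := exists_subset_card_eq (s := Aᶜ) (n := i)
    (by rw [card_compl, Fintype.card_fin]; omega)
  have hdisj : Disjoint A D := disjoint_left.2 fun a ha hd => (mem_compl.1 (hD hd)) ha
  refine ⟨A, C ∪ D, hA, ?_, ?_⟩
  · rw [card_union_of_disjoint (disjoint_of_subset_left hC hdisj)]; omega
  · rw [sdiff_union_distrib, sdiff_eq_self_of_disjoint hdisj,
      inter_eq_left.2 sdiff_subset, card_sdiff_of_subset hC]; omega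

/-- The two solutions of the three-term recurrence on `0, …, m` are proportional, since the leading
coefficient `(m - i) (n - m - i)` does not vanish for `i < m`. -/
theorem exists_projEntry_eq_mul_hahn {n m x : ℕ} (hx : x ≤ m) (hmn : m ≤ n - m) :
    ∃ κ₀ : ℂ, ∀ A B : Finset (Fin n), #A = m → #B = m →
      projEntry n x A B = κ₀ * hahn n m x #(A \ B) := by
  obtain ⟨κ, hκ⟩ := exists_projEntry_eq n m x
  have step : ∀ i ≤ m, ((m : ℂ) - i) * ((n : ℂ) - m - i) * (κ (i + 1) - κ i) +
      (i : ℂ) ^ 2 * (κ (i - 1) - κ i) = -(x * ((n : ℂ) - x + 1)) * κ i := by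
    intro i hi
    obtain ⟨A, B, hA, hB, rfl⟩ := exists_pair_card_sdiff hi hmn
    have h1 := sum_swap_distance κ hA hB
    have h2 := sum_projEntry_swap (n := n) (x := x) (by omega) A B
    simp only [sum_sub_distrib, sum_const, card_fin, nsmul_eq_mul] at h1
    rw [hκ A B hA hB, sum_congr rfl fun s _ => sum_congr rfl fun t _ =>
      hκ A (B.map (Equiv.swap s t).toEmbedding) hA (by rw [card_map, hB])] at h2
    rw [h2] at h1
    linear_combination (-1 / 2 : ℂ) * h1
  have sol : ∀ i, i ≤ m → κ i = κ 0 * hahn n m x i ∧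
      (i + 1 ≤ m → κ (i + 1) = κ 0 * hahn n m x (i + 1)) := by
    intro i
    induction i with
    | zero =>
      intro _
      have h0 : κ 0 = κ 0 * hahn n m x 0 := by rw [hahn_zero, mul_one]
      refine ⟨h0, fun h1 => ?_⟩
      have r1 := step 0 (Nat.zero_le _)
      have r2 := hahn_recurrence (n := n) 0 hx hmn
      have ne : ((m : ℂ) - (0 : ℕ)) * ((n : ℂ) - m - (0 : ℕ)) ≠ 0 := by
        rw [← Nat.cast_sub (by omega : m ≤ n), ← Nat.cast_sub (by omega), ← Nat.cast_sub (by omega),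
          ← Nat.cast_mul, Nat.cast_ne_zero]
        exact Nat.mul_ne_zero (by omega) (by omega)
      apply mul_left_cancel₀ ne
      push_cast at r1 r2 ⊢
      linear_combination r1 - κ 0 * r2 + (-(x * ((n : ℂ) - x + 1)) + m * (n - m)) * h0
    | succ i ih =>
      intro hi
      obtain ⟨hi0, hi1⟩ := ih (by omega)
      refine ⟨hi1 hi, fun h2 => ?_⟩
      have r1 := step (i + 1) hi
      have r2 := hahn_recurrence (n := n) (i + 1) hx hmn
      have ne : ((m : ℂ) - (i + 1 : ℕ)) * ((n : ℂ) - m - (i + 1 : ℕ)) ≠ 0 := by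
        rw [← Nat.cast_sub (by omega : m ≤ n), ← Nat.cast_sub (by omega), ← Nat.cast_sub (by omega),
          ← Nat.cast_mul, Nat.cast_ne_zero]
        exact Nat.mul_ne_zero (by omega) (by omega)
      apply mul_left_cancel₀ ne
      rw [Nat.add_sub_cancel, hi0, hi1 hi] at r1
      rw [Nat.add_sub_cancel] at r2
      linear_combination r1 - κ 0 * r2
  refine ⟨κ 0, fun A B hA hB => ?_⟩
  rw [hκ A B hA hB]
  exact (sol _ (hA ▸ card_le_card sdiff_subset)).1

/-! ### Raising and lowering operators -/

/-- The raising operator of the `sl₂`-action: it turns one letter `0` into `1`, in all ways. -/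
noncomputable def raise (n : ℕ) : Qubits n →ₗ[ℂ] Qubits n where
  toFun f := WithLp.toLp 2 fun w =>
    ∑ s ∈ (wordEquiv n).symm w, f (indWord (((wordEquiv n).symm w).erase s))
  map_add' f g := by ext w; simp [sum_add_distrib]
  map_smul' c f := by ext w; simp [mul_sum]

/-- The lowering operator of the `sl₂`-action: it turns one letter `1` into `0`, in all ways. -/
noncomputable def lower (n : ℕ) : Qubits n →ₗ[ℂ] Qubits n where
  toFun f := WithLp.toLp 2 fun w =>
    ∑ s ∈ ((wordEquiv n).symm w)ᶜ, f (indWord (insert s ((wordEquiv n).symm w)))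
  map_add' f g := by ext w; simp [sum_add_distrib]
  map_smul' c f := by ext w; simp [mul_sum]

theorem wordEquiv_symm_indWord {n : ℕ} (B : Finset (Fin n)) : (wordEquiv n).symm (indWord B) = B :=
  (wordEquiv n).symm_apply_apply B

theorem raise_apply {n : ℕ} (f : Qubits n) (B : Finset (Fin n)) :
    raise n f (indWord B) = ∑ s ∈ B, f (indWord (B.erase s)) := by
  simp [raise, wordEquiv_symm_indWord]

theorem lower_apply {n : ℕ} (f : Qubits n) (B : Finset (Fin n)) :
    lower n f (indWord B) = ∑ s ∈ Bᶜ, f (indWord (insert s B)) := by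
  simp [lower, wordEquiv_symm_indWord]

theorem raise_permRep {n : ℕ} (g : Equiv.Perm (Fin n)) (f : Qubits n) :
    raise n (permRep n g f) = permRep n g (raise n f) := by
  refine qubits_ext fun B => ?_
  simp [raise_apply, permRep_indWord, map_erase]

theorem lower_permRep {n : ℕ} (g : Equiv.Perm (Fin n)) (f : Qubits n) :
    lower n (permRep n g f) = permRep n g (lower n f) := by
  refine qubits_ext fun B => ?_
  have h : (B.map (g⁻¹).toEmbedding)ᶜ = Bᶜ.map (g⁻¹).toEmbedding := by
    ext s; simp only [mem_compl, mem_map_equiv]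
  simp [lower_apply, permRep_indWord, map_insert, h]

/-- The commutation relation of `sl₂`. -/
theorem lower_raise {n : ℕ} (f : Qubits n) (B : Finset (Fin n)) :
    lower n (raise n f) (indWord B) =
      raise n (lower n f) (indWord B) + ((n : ℂ) - 2 * #B) * f (indWord B) := by
  rw [lower_apply, raise_apply]
  have h1 : ∀ s ∈ Bᶜ, raise n f (indWord (insert s B)) =
      f (indWord B) + ∑ r ∈ B, f (indWord ((insert s B).erase r)) := by
    intro s hs
    rw [mem_compl] at hs
    rw [raise_apply, sum_insert hs, erase_insert hs]
  have h2 : ∀ r ∈ B, lower n f (indWord (B.erase r)) =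
      f (indWord B) + ∑ s ∈ Bᶜ, f (indWord ((insert s B).erase r)) := by
    intro r hr
    rw [lower_apply, compl_erase, sum_insert (by simpa using hr), insert_erase hr]
    congr 1
    refine sum_congr rfl fun s hs => ?_
    rw [erase_insert_of_ne]
    rintro rfl; exact (mem_compl.1 hs) hr
  rw [sum_congr rfl h1, sum_congr rfl h2, sum_add_distrib, sum_add_distrib, sum_comm, sum_const,
    sum_const, card_compl, Fintype.card_fin, nsmul_eq_mul, nsmul_eq_mul,
    Nat.cast_sub (by simpa using card_le_univ B)]
  ring

/-- The vectors that are supported on the words with exactly `w` letters `1`. -/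
def weightSpace (n w : ℕ) : Submodule ℂ (Qubits n) where
  carrier := {f | ∀ B, f (indWord B) ≠ 0 → #B = w}
  zero_mem' := by intro B h; simp at h
  add_mem' := by
    intro f g hf hg B h
    by_contra hB
    have h1 : f (indWord B) = 0 := by_contra fun h' => hB (hf B h')
    have h2 : g (indWord B) = 0 := by_contra fun h' => hB (hg B h')
    simp [h1, h2] at h
  smul_mem' := by
    intro c f hf B h
    exact hf B (by rintro h'; simp [h'] at h)

theorem permRep_mem_weightSpace {n w : ℕ} (g : Equiv.Perm (Fin n)) {f : Qubits n}
    (hf : f ∈ weightSpace n w) : permRep n g f ∈ weightSpace n w := by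
  intro B h
  rw [permRep_indWord] at h
  simpa using hf _ h

theorem raise_mem_weightSpace {n w : ℕ} {f : Qubits n} (hf : f ∈ weightSpace n w) :
    raise n f ∈ weightSpace n (w + 1) := by
  intro B h
  rw [raise_apply] at h
  obtain ⟨s, hs, h'⟩ := exists_ne_zero_of_sum_ne_zero h
  rw [← hf _ h', card_erase_add_one hs]

theorem lower_raise_of_mem {n w : ℕ} {f : Qubits n} (hf : f ∈ weightSpace n w) :
    lower n (raise n f) = raise n (lower n f) + ((n : ℂ) - 2 * w) • f := by
  refine qubits_ext fun B => ?_
  rw [lower_raise]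
  by_cases h : f (indWord B) = 0
  · simp [h]
  · simp [hf B h]

theorem raise_pow_mem_weightSpace {n w : ℕ} {f : Qubits n} (hf : f ∈ weightSpace n w) (j : ℕ) :
    (raise n ^ j) f ∈ weightSpace n (w + j) := by
  induction j with
  | zero => simpa using hf
  | succ j ih => rw [pow_succ', Module.End.mul_apply]; exact raise_mem_weightSpace ih

theorem lower_raise_pow {n w : ℕ} {f : Qubits n} (hf : f ∈ weightSpace n w) (h0 : lower n f = 0)
    (j : ℕ) : lower n ((raise n ^ (j + 1)) f) =
      (((j : ℂ) + 1) * ((n : ℂ) - 2 * w - j)) • (raise n ^ j) f := by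
  induction j with
  | zero => simp [lower_raise_of_mem hf, h0]
  | succ j ih =>
    rw [pow_succ', Module.End.mul_apply, lower_raise_of_mem (raise_pow_mem_weightSpace hf _), ih,
      map_smul, ← Module.End.mul_apply, ← pow_succ', ← add_smul]
    congr 1
    push_cast
    ring

/-- A non-zero lowest weight vector with `w` letters `1` survives `n - 2 * w` raisings. -/
theorem eq_zero_of_raise_pow_eq_zero {n w : ℕ} {f : Qubits n} (hf : f ∈ weightSpace n w)
    (h0 : lower n f = 0) {j : ℕ} (hj : 2 * w + j ≤ n) (h : (raise n ^ j) f = 0) : f = 0 := by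
  induction j with
  | zero => simpa using h
  | succ j ih =>
    apply ih (by omega)
    have h1 := lower_raise_pow hf h0 j
    rw [h, map_zero] at h1
    refine (smul_eq_zero.1 h1.symm).resolve_left (mul_ne_zero (Nat.cast_add_one_ne_zero j) ?_)
    have : (n : ℂ) - 2 * w - j = ((n - 2 * w - j : ℕ) : ℂ) := by
      rw [Nat.cast_sub (by omega), Nat.cast_sub (by omega)]; push_cast; ring
    rw [this, Nat.cast_ne_zero]
    omega

/-! ### Products of singlets -/

section Singlet

variable {n x : ℕ} {p q : Fin x → Fin n}

/-- Antisymmetry under the exchange of `p j` and `q j`, for every `j`. -/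
def IsPairAlternating (p q : Fin x → Fin n) (f : Qubits n) : Prop :=
  ∀ j, permRep n (Equiv.swap (p j) (q j)) f = -f

/-- Exchanging two equal letters fixes the coordinate and negates it. -/
theorem IsPairAlternating.mem_iff_notMem {f : Qubits n} (hf : IsPairAlternating p q f)
    {B : Finset (Fin n)} (hB : f (indWord B) ≠ 0) (j : Fin x) : p j ∈ B ↔ q j ∉ B := by
  by_contra h
  have h' : p j ∈ B ↔ q j ∈ B := by tauto
  have := congrArg (fun f : Qubits n => f (indWord B)) (hf j)
  dsimp only at this
  rw [permRep_indWord, Equiv.swap_inv, map_swap_of_iff h', PiLp.neg_apply] at this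
  exact hB (self_eq_neg.1 this)

theorem card_inter_pairs (hp : Function.Injective p) (hq : Function.Injective q)
    (hpq : ∀ i j, p i ≠ q j) {B : Finset (Fin n)} (hB : ∀ j, p j ∈ B ↔ q j ∉ B) :
    #(B ∩ (univ.image p ∪ univ.image q)) = x := by
  have e : B ∩ (univ.image p ∪ univ.image q) =
      univ.image fun j => if p j ∈ B then p j else q j := by
    ext s
    simp only [mem_inter, mem_union, mem_image, mem_univ, true_and]
    constructor
    · rintro ⟨hs, ⟨j, rfl⟩ | ⟨j, rfl⟩⟩
      · exact ⟨j, if_pos hs⟩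
      · exact ⟨j, if_neg fun h => (hB j).1 h hs⟩
    · rintro ⟨j, rfl⟩
      split_ifs with h
      · exact ⟨h, Or.inl ⟨j, rfl⟩⟩
      · exact ⟨by by_contra h'; exact h ((hB j).2 h'), Or.inr ⟨j, rfl⟩⟩
  rw [e, card_image_of_injective, card_univ, Fintype.card_fin]
  intro i j hij
  dsimp only at hij
  split_ifs at hij
  · exact hp hij
  · exact absurd hij (hpq _ _)
  · exact absurd hij.symm (hpq _ _)
  · exact hq hij

/-- An alternating vector in which only `x` letters are `1` is determined by one coordinate. -/
theorem IsPairAlternating.eq_zero (hp : Function.Injective p) (hq : Function.Injective q)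
    (hpq : ∀ i j, p i ≠ q j) {f : Qubits n} (hf : IsPairAlternating p q f)
    (hw : f ∈ weightSpace n x) (h0 : f (indWord (univ.image q)) = 0) : f = 0 := by
  -- exchanges move the letters `1` from the places `p j` to the places `q j` one by one
  have key : ∀ k, ∀ B : Finset (Fin n), #(univ.filter fun j => p j ∈ B) = k → f (indWord B) = 0 := by
    intro k
    induction k with
    | zero =>
      intro B hk
      by_contra hB
      rw [card_eq_zero, filter_eq_empty_iff] at hk
      have hsub : univ.image q ⊆ B := by
        intro s hs
        obtain ⟨j, -, rfl⟩ := mem_image.1 hs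
        by_contra h
        exact hk (mem_univ j) ((hf.mem_iff_notMem hB j).2 h)
      have := eq_of_subset_of_card_le hsub
        (by rw [hw B hB, card_image_of_injective _ hq, card_univ, Fintype.card_fin])
      exact hB (this ▸ h0)
    | succ k ih =>
      intro B hk
      by_contra hB
      obtain ⟨j, hj⟩ : (univ.filter fun j => p j ∈ B).Nonempty := by
        rw [← card_pos]; omega
      simp only [mem_filter, mem_univ, true_and] at hj
      have hqj := (hf.mem_iff_notMem hB j).1 hj
      have h1 := ih (B.map (Equiv.swap (p j) (q j)).toEmbedding) (by
        rw [map_swap_of_mem_of_notMem hj hqj]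
        have : (univ.filter fun i => p i ∈ insert (q j) (B.erase (p j))) =
            (univ.filter fun i => p i ∈ B).erase j := by
          ext i
          simp [hpq, hp.eq_iff]
        rw [this, card_erase_of_mem (by simpa using hj), hk, Nat.add_sub_cancel])
      have := congrArg (fun f : Qubits n => f (indWord B)) (hf j)
      dsimp only at this
      rw [permRep_indWord, Equiv.swap_inv, h1, PiLp.neg_apply] at this
      exact hB (neg_eq_zero.1 this.symm)
  exact qubits_ext fun B => by rw [key _ B rfl]; rfl

/-- The coordinates of a product of singlets on the pairs `p j, q j`. -/
noncomputable def pairSign (p q : Fin x → Fin n) (B : Finset (Fin n)) : ℂ :=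
  ∏ j, ((if q j ∈ B then 1 else 0) - (if p j ∈ B then 1 else 0))

/-- The tensor product of the singlets `|01⟩ - |10⟩` on the pairs of places `p j, q j` and of the sum
of all words with `m - x` letters `1` on the remaining places. -/
noncomputable def singletVec (p q : Fin x → Fin n) (m : ℕ) : Qubits n :=
  WithLp.toLp 2 fun w =>
    if #((wordEquiv n).symm w) = m then pairSign p q ((wordEquiv n).symm w) else 0

theorem singletVec_apply (m : ℕ) (B : Finset (Fin n)) :
    singletVec p q m (indWord B) = if #B = m then pairSign p q B else 0 := by
  simp [singletVec, wordEquiv_symm_indWord]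

theorem singletVec_mem_weightSpace (m : ℕ) : singletVec p q m ∈ weightSpace n m := by
  intro B h
  rw [singletVec_apply] at h
  exact by_contra fun h' => h (if_neg h')

theorem pairSign_map_swap (hp : Function.Injective p) (hq : Function.Injective q)
    (hpq : ∀ i j, p i ≠ q j) (j : Fin x) (B : Finset (Fin n)) :
    pairSign p q (B.map (Equiv.swap (p j) (q j)).toEmbedding) = -pairSign p q B := by
  rw [pairSign, pairSign, ← mul_prod_erase univ _ (mem_univ j), ← mul_prod_erase univ _ (mem_univ j),
    ← neg_mul, neg_sub]
  congr 1
  · simp only [mem_map_equiv, Equiv.symm_swap, Equiv.swap_apply_left, Equiv.swap_apply_right]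
  · refine prod_congr rfl fun i hi => ?_
    have hij := ne_of_mem_erase hi
    simp only [mem_map_equiv, Equiv.symm_swap]
    rw [Equiv.swap_apply_of_ne_of_ne (hpq j i).symm (hq.ne hij),
      Equiv.swap_apply_of_ne_of_ne (hp.ne hij) (hpq i j)]

theorem isPairAlternating_singletVec (hp : Function.Injective p) (hq : Function.Injective q)
    (hpq : ∀ i j, p i ≠ q j) (m : ℕ) : IsPairAlternating p q (singletVec p q m) := by
  intro j
  refine qubits_ext fun B => ?_
  rw [permRep_indWord, singletVec_apply, PiLp.neg_apply, singletVec_apply, Equiv.swap_inv, card_map,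
    pairSign_map_swap hp hq hpq]
  split_ifs <;> simp

/-- The lowered vector is still alternating, but `x - 1` letters `1` cannot meet all of the `x` pairs. -/
theorem lower_singletVec (hp : Function.Injective p) (hq : Function.Injective q)
    (hpq : ∀ i j, p i ≠ q j) : lower n (singletVec p q x) = 0 := by
  refine qubits_ext fun B => ?_
  by_contra h
  have alt : IsPairAlternating p q (lower n (singletVec p q x)) := fun j => by
    rw [← lower_permRep, isPairAlternating_singletVec hp hq hpq, map_neg]
  have hB := card_inter_pairs hp hq hpq (alt.mem_iff_notMem h)
  have hle := card_le_card (inter_subset_left : B ∩ (univ.image p ∪ univ.image q) ⊆ B)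
  change lower n (singletVec p q x) (indWord B) ≠ 0 at h
  rw [lower_apply] at h
  obtain ⟨s, hs, hs'⟩ := exists_ne_zero_of_sum_ne_zero h
  have := singletVec_mem_weightSpace x _ hs'
  rw [card_insert_of_notMem (mem_compl.1 hs)] at this
  omega

/-- Raising inside a pair gives nothing, so only the letters `1` outside of the pairs count. -/
theorem raise_singletVec (hp : Function.Injective p) (hq : Function.Injective q)
    (hpq : ∀ i j, p i ≠ q j) (j : ℕ) :
    raise n (singletVec p q (x + j)) = ((j : ℂ) + 1) • singletVec p q (x + (j + 1)) := by
  have alt : ∀ m, IsPairAlternating p q (singletVec p q m) := isPairAlternating_singletVec hp hq hpq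
  have altR : IsPairAlternating p q (raise n (singletVec p q (x + j))) := fun j => by
    rw [← raise_permRep, alt, map_neg]
  refine qubits_ext fun B => ?_
  rw [PiLp.smul_apply, smul_eq_mul]
  by_cases hB : #B = x + (j + 1)
  swap
  · rw [singletVec_apply, if_neg hB, mul_zero]
    by_contra h
    exact hB (raise_mem_weightSpace (singletVec_mem_weightSpace _) B h)
  by_cases htr : ∀ i, p i ∈ B ↔ q i ∉ B
  swap
  · rw [of_not_not fun h => htr (altR.mem_iff_notMem (B := B) h),
      of_not_not fun h => htr ((alt (x + (j + 1))).mem_iff_notMem (B := B) h), mul_zero]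
  have hcard := card_inter_pairs hp hq hpq htr
  rw [raise_apply, ← sum_inter_add_sum_sdiff B (univ.image p ∪ univ.image q), sum_eq_zero,
    zero_add, sum_congr rfl (g := fun _ => singletVec p q (x + (j + 1)) (indWord B)), sum_const,
    nsmul_eq_mul]
  · congr 1
    have := card_sdiff_add_card_inter B (univ.image p ∪ univ.image q)
    rw [show #(B \ (univ.image p ∪ univ.image q)) = j + 1 by omega]
    push_cast; rfl
  · intro s hs
    simp only [mem_sdiff, mem_union, mem_image, mem_univ, true_and, not_or, not_exists] at hs
    rw [singletVec_apply, singletVec_apply, if_pos hB, if_pos (by rw [card_erase_of_mem hs.1]; omega)]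
    simp only [pairSign, mem_erase, ne_eq, hs.2.1, hs.2.2, not_false_eq_true, true_and]
  · intro s hs
    by_contra h
    have h' := (alt _).mem_iff_notMem h
    simp only [mem_inter, mem_union, mem_image, mem_univ, true_and] at hs
    obtain ⟨hs1, ⟨i, rfl⟩ | ⟨i, rfl⟩⟩ := hs
    · have := h' i; have := htr i; simp_all
    · have := h' i; have := htr i; simp_all

theorem raise_pow_singletVec (hp : Function.Injective p) (hq : Function.Injective q)
    (hpq : ∀ i j, p i ≠ q j) (j : ℕ) :
    (raise n ^ j) (singletVec p q x) = (j ! : ℂ) • singletVec p q (x + j) := by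
  induction j with
  | zero => simp
  | succ j ih =>
    rw [pow_succ', Module.End.mul_apply, ih, map_smul, raise_singletVec hp hq hpq, smul_smul,
      Nat.factorial_succ]
    congr 1
    push_cast; ring

end Singlet

/-! ### The singlet vectors lie in the isotypical component -/

theorem nonempty_equiv_map {R M M' : Type*} [Ring R] [AddCommGroup M] [Module R M]
    [AddCommGroup M'] [Module R M'] (f : M →ₗ[R] M') (N : Submodule R M)
    (h : ∀ v ∈ N, f v = 0 → v = 0) : Nonempty (N ≃ₗ[R] N.map f) := by
  have inj : Function.Injective (f.domRestrict N) := by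
    rw [← LinearMap.ker_eq_bot, LinearMap.ker_eq_bot']
    intro v hv
    exact Subtype.ext (h v v.2 hv)
  exact ⟨(LinearEquiv.ofInjective _ inj).trans (LinearEquiv.ofEq _ _ (LinearMap.range_domRestrict _ _))⟩

/-- The embedding of the permutation module on the sets of size `#T` into the group algebra which
sends a set to the sum of all permutations that carry `T` to it, extended by zero. -/
noncomputable def toGroupAlgebra {n : ℕ} (T : Finset (Fin n)) :
    (permRep n).asModule →ₗ[MonoidAlgebra ℂ (Equiv.Perm (Fin n))]
      MonoidAlgebra ℂ (Equiv.Perm (Fin n)) :=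
  MonoidAlgebra.equivariantOfLinearOfComm
    { toFun := fun v => ∑ g : Equiv.Perm (Fin n), MonoidAlgebra.single g
        ((permRep n).asModuleEquiv v (indWord (T.map g.toEmbedding)))
      map_add' := fun u v => by simp [MonoidAlgebra.single_add, sum_add_distrib]
      map_smul' := fun c v => by simp [smul_sum, MonoidAlgebra.smul_single] }
    (fun h v => by
      simp only [LinearMap.coe_mk, AddHom.coe_mk, smul_eq_mul, mul_sum,
        MonoidAlgebra.single_mul_single, one_mul]
      rw [← Equiv.sum_comp (Equiv.mulLeft h)]
      refine sum_congr rfl fun g _ => ?_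
      rw [Representation.asModuleEquiv_map_smul, Representation.asAlgebraHom_single, one_smul,
        permRep_indWord]
      have : (T.map (Equiv.mulLeft h g).toEmbedding).map (h⁻¹).toEmbedding = T.map g.toEmbedding := by
        ext s
        simp only [mem_map_equiv]
        exact iff_of_eq (congrArg (· ∈ T) (by
          rw [Equiv.symm_apply_eq]; simp [← Equiv.Perm.inv_def]))
      rw [this]
      rfl)

theorem toGroupAlgebra_apply {n : ℕ} (T : Finset (Fin n)) (v : (permRep n).asModule) :
    toGroupAlgebra T v = ∑ g : Equiv.Perm (Fin n), MonoidAlgebra.single g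
        ((permRep n).asModuleEquiv v (indWord (T.map g.toEmbedding))) := rfl

theorem toGroupAlgebra_coeff {n : ℕ} (T : Finset (Fin n)) (v : (permRep n).asModule)
    (g : Equiv.Perm (Fin n)) :
    (toGroupAlgebra T v).coeff g = (permRep n).asModuleEquiv v (indWord (T.map g.toEmbedding)) := by
  simp [toGroupAlgebra_apply, Finsupp.single_apply]

/-- Injectivity: every set of size `#T` is a translate of `T`. -/
theorem eq_zero_of_toGroupAlgebra_eq_zero {n : ℕ} {T : Finset (Fin n)} {v : (permRep n).asModule}
    (hv : (permRep n).asModuleEquiv v ∈ weightSpace n #T) (h : toGroupAlgebra T v = 0) : v = 0 := by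
  apply (permRep n).asModuleEquiv.injective
  rw [map_zero]
  refine qubits_ext fun B => ?_
  by_contra hB
  obtain ⟨g, hg, -⟩ := exists_perm_map_eq (A := T) (B := T) (A' := B) (B' := B) (hv B hB).symm
    (hv B hB).symm (by simp)
  have := toGroupAlgebra_coeff T v g
  rw [h, hg] at this
  exact hB this.symm

/-- Linear operators that commute with the symmetric group, as module homomorphisms. -/
noncomputable def equivariantEnd {n : ℕ} (F : Qubits n →ₗ[ℂ] Qubits n)
    (hF : ∀ g v, F (permRep n g v) = permRep n g (F v)) :
    (permRep n).asModule →ₗ[MonoidAlgebra ℂ (Equiv.Perm (Fin n))] (permRep n).asModule :=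
  MonoidAlgebra.equivariantOfLinearOfComm
    ((permRep n).asModuleEquiv.symm.toLinearMap ∘ₗ F ∘ₗ (permRep n).asModuleEquiv.toLinearMap)
    (fun g v => by
      simp only [LinearMap.comp_apply, LinearEquiv.coe_coe]
      rw [Representation.asModuleEquiv_map_smul, Representation.asAlgebraHom_single, one_smul, hF,
        Representation.asModuleEquiv_symm_map_rho]
      rfl)

theorem asModuleEquiv_equivariantEnd {n : ℕ} (F : Qubits n →ₗ[ℂ] Qubits n)
    (hF : ∀ g v, F (permRep n g v) = permRep n g (F v)) (v : (permRep n).asModule) :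
    (permRep n).asModuleEquiv (equivariantEnd F hF v) = F ((permRep n).asModuleEquiv v) := rfl

theorem raise_pow_permRep {n : ℕ} (j : ℕ) (g : Equiv.Perm (Fin n)) (f : Qubits n) :
    (raise n ^ j) (permRep n g f) = permRep n g ((raise n ^ j) f) := by
  induction j with
  | zero => rfl
  | succ j ih => rw [pow_succ', Module.End.mul_apply, ih, raise_permRep, Module.End.mul_apply]

theorem asModuleEquiv_smul_mem {n : ℕ} (U : Submodule ℂ (Qubits n))
    (hU : ∀ g, ∀ v ∈ U, permRep n g v ∈ U) (r : MonoidAlgebra ℂ (Equiv.Perm (Fin n)))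
    {v : (permRep n).asModule} (hv : (permRep n).asModuleEquiv v ∈ U) :
    (permRep n).asModuleEquiv (r • v) ∈ U := by
  induction r using MonoidAlgebra.induction_on with
  | of g =>
    rw [Representation.asModuleEquiv_map_smul, Representation.asAlgebraHom_of]
    exact hU g _ hv
  | add a b ha hb => rw [add_smul, map_add]; exact U.add_mem ha hb
  | smul c a ha => rw [smul_assoc, map_smul]; exact U.smul_mem c ha

/-- The place of the `j`-th box in the first row. -/
def topBox {n x : ℕ} (hx : 2 * x ≤ n) (j : Fin x) : Fin n := ⟨j, by omega⟩

/-- The place of the `j`-th box in the second row. -/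
def bottomBox {n x : ℕ} (hx : 2 * x ≤ n) (j : Fin x) : Fin n := ⟨n - x + j, by omega⟩

section Boxes

variable {n x : ℕ} (hx : 2 * x ≤ n)

theorem topBox_injective : Function.Injective (topBox hx) := fun i j h => by
  simpa [topBox, Fin.ext_iff] using h

theorem bottomBox_injective : Function.Injective (bottomBox hx) := fun i j h => by
  simpa [bottomBox, Fin.ext_iff] using h

theorem topBox_ne_bottomBox (i j : Fin x) : topBox hx i ≠ bottomBox hx j := by
  simp only [topBox, bottomBox, ne_eq, Fin.ext_iff]; omega

theorem mem_image_bottomBox {s : Fin n} : s ∈ univ.image (bottomBox hx) ↔ rowOf n x s = 1 := by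
  simp only [mem_image, mem_univ, true_and, rowOf, bottomBox, Fin.ext_iff]
  constructor
  · rintro ⟨j, hj⟩; rw [if_neg (by omega)]
  · intro h
    have : ¬ (s : ℕ) < n - x := fun h' => by rw [if_pos h'] at h; omega
    exact ⟨⟨s - (n - x), by omega⟩, by dsimp only; omega⟩

theorem map_bottom_eq_iff (g : Equiv.Perm (Fin n)) :
    (univ.image (bottomBox hx)).map g.toEmbedding = univ.image (bottomBox hx) ↔
      ∀ i, rowOf n x (g i) = rowOf n x i := by
  have h01 : ∀ s, rowOf n x s = 0 ∨ rowOf n x s = 1 := fun s => by unfold rowOf; split_ifs <;> simp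
  constructor
  · intro h i
    have h1 : g i ∈ (univ.image (bottomBox hx)).map g.toEmbedding ↔ _ := mem_map_equiv
    rw [h, mem_image_bottomBox, Equiv.symm_apply_apply, mem_image_bottomBox] at h1
    rcases h01 i with h2 | h2 <;> rcases h01 (g i) with h3 | h3 <;> simp_all
  · intro h
    ext s
    rw [mem_map_equiv, mem_image_bottomBox, mem_image_bottomBox, ← h, Equiv.apply_symm_apply]

/-- The permutations that fix the set of the second row form the row group. -/
theorem toGroupAlgebra_ket :
    toGroupAlgebra (univ.image (bottomBox hx)) ((permRep n).asModuleEquiv.symm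
      (ket (indWord (univ.image (bottomBox hx))))) = rowSym (rowOf n x) := by
  rw [toGroupAlgebra_apply, rowSym, sum_filter]
  refine sum_congr rfl fun g _ => ?_
  rw [LinearEquiv.apply_symm_apply, ket_apply]
  by_cases h : ∀ i, rowOf n x (g i) = rowOf n x i
  · rw [if_pos h, if_pos ((map_bottom_eq_iff hx g).2 h)]
  · rw [if_neg h, if_neg (mt (map_bottom_eq_iff hx g).1 h), MonoidAlgebra.single_zero]

/-- Antisymmetrizing the word `0 ⋯ 0 1 ⋯ 1` over the columns gives the product of singlets. -/
theorem colAntisym_smul_ket :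
    colAntisym (colOf n x) • (permRep n).asModuleEquiv.symm
      (ket (indWord (univ.image (bottomBox hx)))) =
    (permRep n).asModuleEquiv.symm (singletVec (topBox hx) (bottomBox hx) x) := by
  set T := univ.image (bottomBox hx) with hT
  set u := (permRep n).asModuleEquiv.symm (ket (indWord T)) with hu
  have hp := topBox_injective hx
  have hq := bottomBox_injective hx
  have hpq := topBox_ne_bottomBox hx
  have hTx : #T = x := by rw [hT, card_image_of_injective _ hq, card_univ, Fintype.card_fin]
  set e := (permRep n).asModuleEquiv (colAntisym (colOf n x) • u) with he
  have alt : IsPairAlternating (topBox hx) (bottomBox hx) e := fun j => by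
    have := single_swap_mul_colAntisym (col := colOf n x) (s := topBox hx j) (t := bottomBox hx j)
      (by
        have h1 : (topBox hx j : ℕ) = j := rfl
        have h2 : (bottomBox hx j : ℕ) = n - x + j := rfl
        unfold colOf; split_ifs <;> omega) (hpq j j)
    have h2 := congrArg (fun r => (permRep n).asModuleEquiv (r • u)) this
    rwa [mul_smul, Representation.asModuleEquiv_map_smul, Representation.asAlgebraHom_single,
      one_smul, neg_smul, map_neg] at h2
  have wt : e ∈ weightSpace n x := by
    refine asModuleEquiv_smul_mem _ (fun g v hv => permRep_mem_weightSpace g hv) _ ?_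
    rw [hu, LinearEquiv.apply_symm_apply]
    intro B hB
    rw [ket_apply] at hB
    rw [← hTx, of_not_not fun h => hB (if_neg h)]
  have val : e (indWord T) = 1 := by
    rw [he, Representation.asModuleEquiv_map_smul, hu, LinearEquiv.apply_symm_apply, colAntisym,
      map_sum, LinearMap.sum_apply]
    simp only [Representation.asAlgebraHom_single, LinearMap.smul_apply, permRep_ket_indWord]
    -- a permutation that preserves rows and columns is trivial
    rw [WithLp.ofLp_sum, Finset.sum_apply, sum_eq_single 1]
    · simp only [PiLp.smul_apply]
      rw [ket_apply, if_pos]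
      · simp
      · ext s; rw [mem_map_equiv]; rfl
    · intro g hg hg1
      simp only [PiLp.smul_apply]
      rw [ket_apply, if_neg, smul_zero]
      intro h
      apply hg1
      have hr := (map_bottom_eq_iff hx g).1 h.symm
      have hc := (mem_filter.1 hg).2
      ext i
      have h1 := hr i
      have h2 := hc i
      rw [Equiv.Perm.one_apply]
      simp only [rowOf, colOf] at h1 h2
      split_ifs at h1 h2 <;> omega
    · intro h; simp at h
  have val' : singletVec (topBox hx) (bottomBox hx) x (indWord T) = 1 := by
    rw [singletVec_apply, if_pos hTx, pairSign]
    refine prod_eq_one fun j _ => ?_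
    rw [if_pos (mem_image_of_mem _ (mem_univ j)), if_neg, sub_zero]
    intro h
    obtain ⟨i, -, hi⟩ := mem_image.1 h
    exact hpq j i hi.symm
  -- both vectors are alternating, so one coordinate decides
  have hsub : e - singletVec (topBox hx) (bottomBox hx) x = 0 := by
    refine IsPairAlternating.eq_zero hp hq hpq (fun j => ?_)
      (Submodule.sub_mem _ wt (singletVec_mem_weightSpace x)) ?_
    · rw [map_sub, alt, isPairAlternating_singletVec hp hq hpq]; abel
    · rw [PiLp.sub_apply, val, val', sub_self]
  rw [LinearEquiv.eq_symm_apply]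
  exact sub_eq_zero.1 hsub

/-- The products of singlets with symmetrized rest generate copies of the Specht module. -/
theorem singletVec_mem_isotypic {m : ℕ} (hxm : x ≤ m) (hm : x + m ≤ n) :
    singletVec (topBox hx) (bottomBox hx) m ∈ isotypic n x := by
  have hp := topBox_injective hx
  have hq := bottomBox_injective hx
  have hpq := topBox_ne_bottomBox hx
  set T := univ.image (bottomBox hx) with hT
  have hTx : #T = x := by rw [hT, card_image_of_injective _ hq, card_univ, Fintype.card_fin]
  set u := (permRep n).asModuleEquiv.symm (singletVec (topBox hx) (bottomBox hx) x) with hu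
  let N := Submodule.span (MonoidAlgebra ℂ (Equiv.Perm (Fin n))) {u}
  have hN : ∀ v ∈ N, (permRep n).asModuleEquiv v ∈ weightSpace n x ⊓ LinearMap.ker (lower n) := by
    intro v hv
    obtain ⟨r, rfl⟩ := Submodule.mem_span_singleton.1 hv
    refine asModuleEquiv_smul_mem (weightSpace n x ⊓ LinearMap.ker (lower n))
      (fun g w hw => ⟨permRep_mem_weightSpace g hw.1, ?_⟩) r ?_
    · exact LinearMap.mem_ker.2 (by rw [lower_permRep, LinearMap.mem_ker.1 hw.2, map_zero])
    · rw [hu, LinearEquiv.apply_symm_apply]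
      exact ⟨singletVec_mem_weightSpace x, lower_singletVec hp hq hpq⟩
  obtain ⟨e₁⟩ := nonempty_equiv_map (toGroupAlgebra T) N fun v hv h =>
    eq_zero_of_toGroupAlgebra_eq_zero (by rw [hTx]; exact (hN v hv).1) h
  have hSpecht : N.map (toGroupAlgebra T) = twoRowSpecht n x := by
    rw [Submodule.map_span, Set.image_singleton, hu, ← colAntisym_smul_ket hx, map_smul,
      toGroupAlgebra_ket hx]
    rfl
  obtain ⟨e₂⟩ := nonempty_equiv_map
    (equivariantEnd (raise n ^ (m - x)) (raise_pow_permRep (m - x))) N fun v hv h => by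
      have h' := congrArg (permRep n).asModuleEquiv h
      rw [asModuleEquiv_equivariantEnd, map_zero] at h'
      have := eq_zero_of_raise_pow_eq_zero (hN v hv).1 (hN v hv).2 (by omega) h'
      exact (permRep n).asModuleEquiv.injective (by rw [this, map_zero])
  rw [hSpecht] at e₁
  have hmem : (raise n ^ (m - x)) (singletVec (topBox hx) (bottomBox hx) x) ∈ isotypic n x := by
    rw [mem_isotypic, isotypicComponent]
    refine Submodule.mem_sSup_of_mem (S := {N | Nonempty (N ≃ₗ[_] twoRowSpecht n x)})
      ⟨e₂.symm.trans e₁⟩ ?_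
    exact Submodule.mem_map_of_mem (Submodule.mem_span_singleton_self u)
  rw [raise_pow_singletVec hp hq hpq, show x + (m - x) = m by omega] at hmem
  have := (isotypic n x).smul_mem (((m - x)! : ℂ)⁻¹) hmem
  rwa [smul_smul, inv_mul_cancel₀ (by exact_mod_cast Nat.factorial_ne_zero _), one_smul] at this

end Boxes

/-! ### Normalization -/

/-- Double counting of the pairs of a set `B` and a `t`-element subset of `A \ B`. -/
theorem sum_mul_choose_card_sdiff {α : Type*} [Fintype α] [DecidableEq α] (F : Finset α → ℂ)
    (A : Finset α) (m t : ℕ) :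
    ∑ B ∈ powersetCard m univ, F B * ((#(A \ B)).choose t : ℂ) =
      ∑ T ∈ powersetCard t A, ∑ B ∈ powersetCard m Tᶜ, F B := by
  have h1 : ∀ B : Finset α, ((#(A \ B)).choose t : ℂ) =
      ∑ T ∈ powersetCard t A, if Disjoint T B then 1 else 0 := by
    intro B
    rw [← card_powersetCard, ← sum_filter, sum_const, nsmul_one]
    congr 2
    ext T
    simp only [mem_powersetCard, mem_filter, subset_sdiff]
    tauto
  have h2 : ∀ T : Finset α, powersetCard m Tᶜ =
      (powersetCard m univ).filter fun B => Disjoint T B := by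
    intro T
    ext B
    simp only [mem_powersetCard, mem_filter, subset_univ, true_and, subset_compl_iff_disjoint_left]
    tauto
  simp only [h1, h2, sum_filter, mul_sum]
  rw [sum_comm]
  simp

theorem sum_mul_hahn {n : ℕ} {α : Type*} [Fintype α] [DecidableEq α] (F : Finset α → ℂ)
    (A : Finset α) (m r x : ℕ) :
    ∑ B ∈ powersetCard r univ, F B * hahn n m x #(A \ B) =
      ∑ t ∈ range (x + 1), (-1) ^ t * hahnCoeff n m x t *
        ∑ T ∈ powersetCard t A, ∑ B ∈ powersetCard r Tᶜ, F B := by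
  simp only [← sum_mul_choose_card_sdiff, hahn, mul_sum]
  rw [sum_comm]
  exact sum_congr rfl fun t _ => sum_congr rfl fun B _ => by ring

theorem card_filter_subset_powersetCard {α : Type*} [DecidableEq α] {U V : Finset α} (h : U ⊆ V)
    {m : ℕ} (hm : #U ≤ m) :
    #((powersetCard m V).filter fun B => U ⊆ B) = (#V - #U).choose (m - #U) := by
  rw [← card_sdiff_of_subset h, ← card_powersetCard]
  refine card_nbij' (fun B => B \ U) (fun C => C ∪ U) ?_ ?_ ?_ ?_
  · intro B hB
    simp only [coe_filter, mem_powersetCard, Set.mem_ofPred_eq, mem_coe] at hB ⊢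
    exact ⟨sdiff_subset_sdiff hB.1.1 subset_rfl, by rw [card_sdiff_of_subset hB.2, hB.1.2]⟩
  · intro C hC
    simp only [coe_filter, mem_powersetCard, Set.mem_ofPred_eq, mem_coe] at hC ⊢
    have hd : Disjoint C U := (subset_sdiff.1 hC.1).2
    exact ⟨⟨union_subset (hC.1.trans sdiff_subset) h, by
      rw [card_union_of_disjoint hd, hC.2]; omega⟩, subset_union_right⟩
  · intro B hB
    simp only [coe_filter, Set.mem_ofPred_eq] at hB
    exact sdiff_union_of_subset hB.2
  · intro C hC
    simp only [mem_powersetCard, mem_coe] at hC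
    exact union_sdiff_cancel_right (subset_sdiff.1 hC.1).2

section

variable {n x : ℕ} {p q : Fin x → Fin n}

/-- If `T` misses both places of a pair, the exchange of these places pairs off the sets `B`. -/
theorem sum_pairSign_eq_zero (hp : Function.Injective p) (hq : Function.Injective q)
    (hpq : ∀ i j, p i ≠ q j) {T : Finset (Fin n)} {j : Fin x} (h1 : p j ∉ T) (h2 : q j ∉ T) (m : ℕ) :
    ∑ B ∈ powersetCard m Tᶜ, pairSign p q B = 0 := by
  set g := Equiv.swap (p j) (q j)
  have hT : Tᶜ.map g.toEmbedding = Tᶜ := map_swap_of_iff (by simp [h1, h2])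
  have h : ∑ B ∈ powersetCard m Tᶜ, pairSign p q B = -∑ B ∈ powersetCard m Tᶜ, pairSign p q B := by
    rw [← sum_neg_distrib]
    nth_rw 1 [← hT]
    rw [powersetCard_map, sum_map]
    exact sum_congr rfl fun B _ => pairSign_map_swap hp hq hpq j B
  exact self_eq_neg.1 h

/-- The sets that contribute contain all of the places `p j`. -/
theorem sum_pairSign_compl (hp : Function.Injective p) (hq : Function.Injective q)
    (hpq : ∀ i j, p i ≠ q j) {m : ℕ} (hxm : x ≤ m) :
    ∑ B ∈ powersetCard m (univ.image q)ᶜ, pairSign p q B =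
      (-1) ^ x * ((n - 2 * x).choose (m - x) : ℂ) := by
  have h : ∀ B ∈ powersetCard m (univ.image q)ᶜ, pairSign p q B =
      if univ.image p ⊆ B then (-1) ^ x else 0 := by
    intro B hB
    have hB' : ∀ j, q j ∉ B := fun j hj =>
      mem_compl.1 ((mem_powersetCard.1 hB).1 hj) (mem_image_of_mem _ (mem_univ j))
    rw [pairSign]
    simp only [hB', if_false, zero_sub]
    split_ifs with hs
    · rw [prod_congr rfl (g := fun _ => (-1 : ℂ)) fun j _ => by
        rw [if_pos (hs (mem_image_of_mem _ (mem_univ j)))]]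
      simp
    · simp only [subset_iff, mem_image, mem_univ, true_and, not_forall] at hs
      obtain ⟨-, ⟨j, rfl⟩, hj⟩ := hs
      exact prod_eq_zero (mem_univ j) (by simp [hj])
  have cp : #(univ.image p) = x := by rw [card_image_of_injective _ hp, card_univ, Fintype.card_fin]
  have cq : #(univ.image q) = x := by rw [card_image_of_injective _ hq, card_univ, Fintype.card_fin]
  have hsub : univ.image p ⊆ (univ.image q)ᶜ := by
    intro s hs
    obtain ⟨i, -, rfl⟩ := mem_image.1 hs
    simp only [mem_compl, mem_image, mem_univ, true_and, not_exists]
    exact fun j hj => hpq i j hj.symm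
  rw [sum_congr rfl h, ← sum_filter, sum_const, card_filter_subset_powersetCard hsub (by omega),
    card_compl, Fintype.card_fin, cp, cq, nsmul_eq_mul, mul_comm, show n - x - x = n - 2 * x by omega]

end

theorem isotypicProj_apply {n x : ℕ} (f : Qubits n) (A : Finset (Fin n)) :
    isotypicProj n x f (indWord A) = ∑ B, f (indWord B) * projEntry n x A B := by
  have hf : f = ∑ B, f (indWord B) • ket (indWord B) := by
    refine qubits_ext fun C => ?_
    rw [WithLp.ofLp_sum, Finset.sum_apply]
    simp only [PiLp.smul_apply, ket_apply]
    simp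
  conv_lhs => rw [hf]
  rw [map_sum, WithLp.ofLp_sum, Finset.sum_apply]
  simp [projEntry]

/-- The isotypical projector on words with `m` letters `1`. The constant is determined by the fact
that the projector fixes a product of singlets. -/
theorem projEntry_eq {n m x : ℕ} (hxm : x ≤ m) (hmn : m ≤ n - m) {A B : Finset (Fin n)}
    (hA : #A = m) (hB : #B = m) :
    projEntry n x A B = ((n.choose x : ℂ) / (n.choose m : ℂ)) *
      (((n : ℂ) - 2 * x + 1) / ((n : ℂ) - x + 1)) * hahn n m x #(A \ B) := by
  obtain ⟨κ₀, hκ⟩ := exists_projEntry_eq_mul_hahn (n := n) hxm hmn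
  rw [hκ A B hA hB]
  congr 1
  have hx : 2 * x ≤ n := by omega
  have hp := topBox_injective hx
  have hq := bottomBox_injective hx
  have hpq := topBox_ne_bottomBox hx
  set p := topBox hx
  set q := bottomBox hx
  have cp : #(univ.image p) = x := by rw [card_image_of_injective _ hp, card_univ, Fintype.card_fin]
  have cq : #(univ.image q) = x := by rw [card_image_of_injective _ hq, card_univ, Fintype.card_fin]
  have hsub : univ.image q ⊆ (univ.image p)ᶜ := by
    intro s hs
    obtain ⟨i, -, rfl⟩ := mem_image.1 hs
    simp only [mem_compl, mem_image, mem_univ, true_and, not_exists]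
    exact fun j hj => hpq j i hj
  obtain ⟨D, hqD, hDp, hD⟩ := exists_subsuperset_card_eq hsub (n := m) (by omega)
    (by rw [card_compl, Fintype.card_fin]; omega)
  have hpD : ∀ j, p j ∉ D := fun j hj => mem_compl.1 (hDp hj) (mem_image_of_mem _ (mem_univ j))
  have hfix : isotypicProj n x (singletVec p q m) = singletVec p q m :=
    Submodule.starProjection_eq_self_iff.2 (singletVec_mem_isotypic hx hxm (by omega))
  have hval := congrArg (fun f : Qubits n => f (indWord D)) hfix
  have hpair : pairSign p q D = 1 := prod_eq_one fun j _ => by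
    rw [if_pos (hqD (mem_image_of_mem _ (mem_univ j))), if_neg (hpD j), sub_zero]
  dsimp only at hval
  rw [singletVec_apply, if_pos hD, hpair, isotypicProj_apply] at hval
  have hsum : ∑ B, singletVec p q m (indWord B) * projEntry n x D B =
      κ₀ * ∑ B ∈ powersetCard m univ, pairSign p q B * hahn n m x #(D \ B) := by
    rw [mul_sum, ← sum_subset (subset_univ (powersetCard m univ))]
    · refine sum_congr rfl fun B hB => ?_
      have hB := (mem_powersetCard.1 hB).2
      rw [singletVec_apply, if_pos hB, hκ D B hD hB]; ring
    · intro B _ hB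
      rw [singletVec_apply, if_neg, zero_mul]
      exact fun h => hB (mem_powersetCard.2 ⟨subset_univ _, h⟩)
  rw [hsum, sum_mul_hahn] at hval
  -- only the transversal `T` of the pairs contributes
  have hT : ∀ t, ∀ T ∈ powersetCard t D, t ≤ x → T ≠ univ.image q →
      ∑ B ∈ powersetCard m Tᶜ, pairSign p q B = 0 := by
    intro t T hT htx hne
    rw [mem_powersetCard] at hT
    obtain ⟨j, hj⟩ : ∃ j, q j ∉ T := by
      by_contra! h
      refine hne (eq_of_subset_of_card_le (fun s hs => ?_) (by omega)).symm
      obtain ⟨j, -, rfl⟩ := mem_image.1 hs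
      exact h j
    exact sum_pairSign_eq_zero hp hq hpq (fun h => hpD j (hT.1 h)) hj m
  rw [sum_eq_single x, sum_eq_single (univ.image q), sum_pairSign_compl hp hq hpq hxm] at hval
  · have hc := hahnCoeff_self_mul (n := n) hxm hmn
    have h1 : ((-1 : ℂ) ^ x) * (-1) ^ x = 1 := by rw [← mul_pow]; simp
    have hv : κ₀ * (hahnCoeff n m x x * ((n - 2 * x).choose (m - x) : ℂ)) = 1 := by
      rw [← hval]; linear_combination
        (-(κ₀ * (hahnCoeff n m x x * ((n - 2 * x).choose (m - x) : ℂ)))) * h1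
    exact mul_left_cancel₀ (left_ne_zero_of_mul_eq_one hc) (by rw [hc, mul_comm, hv])
  · intro T hTm hne
    exact hT x T hTm le_rfl hne
  · intro h
    exact absurd (mem_powersetCard.2 ⟨hqD, cq⟩) h
  · intro t ht htx
    rw [mem_range] at ht
    rw [sum_eq_zero, mul_zero]
    intro T hTm
    refine hT t T hTm (by omega) ?_
    rintro rfl
    rw [mem_powersetCard, cq] at hTm
    exact htx hTm.2.symm
  · intro h; simp at h

/-! ### The vector `Ξ` -/

/-- The places of the first tensor factor. -/
def leftPlace {a b n : ℕ} (h : a + b = n) : Fin a ↪ Fin n :=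
  (Fin.castAddEmb b).trans (finCongr h).toEmbedding

/-- The places of the second tensor factor. -/
def rightPlace {a b n : ℕ} (h : a + b = n) : Fin b ↪ Fin n :=
  (Fin.natAddEmb a).trans (finCongr h).toEmbedding

theorem leftPlace_ne_rightPlace {a b n : ℕ} (h : a + b = n) (s : Fin a) (t : Fin b) :
    leftPlace h s ≠ rightPlace h t := by
  simp only [leftPlace, rightPlace, ne_eq, Fin.ext_iff, Function.Embedding.trans_apply,
    Equiv.coe_toEmbedding, finCongr_apply_coe, Fin.castAddEmb_apply, Fin.natAddEmb_apply,
    Fin.val_castAdd, Fin.val_natAdd]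
  omega

theorem disjoint_map_places {a b n : ℕ} (h : a + b = n) (L : Finset (Fin a)) (C : Finset (Fin b)) :
    Disjoint (L.map (leftPlace h)) (C.map (rightPlace h)) := by
  rw [disjoint_left]
  intro u hu hu'
  obtain ⟨s, -, rfl⟩ := mem_map.1 hu
  obtain ⟨t, -, ht⟩ := mem_map.1 hu'
  exact leftPlace_ne_rightPlace h s t ht.symm

theorem tensor_ket_indWord {a b n : ℕ} (h : a + b = n) (L : Finset (Fin a)) (C : Finset (Fin b)) :
    tensor h (ket (indWord L)) (ket (indWord C)) =
      ket (indWord (L.map (leftPlace h) ∪ C.map (rightPlace h))) := by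
  subst h
  rw [tensor_ket]
  congr 1
  funext s
  refine Fin.addCases (fun t => ?_) (fun t => ?_) s
  · have h1 : Fin.castAdd b t = leftPlace rfl t := rfl
    have h2 : leftPlace rfl t ∉ C.map (rightPlace (n := a + b) rfl) := by
      rw [mem_map]; rintro ⟨u, -, hu⟩; exact leftPlace_ne_rightPlace rfl t u hu.symm
    rw [Fin.append_left, h1]
    simp only [indWord, mem_union, mem_map', h2, or_false]
  · have h1 : Fin.natAdd a t = rightPlace rfl t := rfl
    have h2 : rightPlace rfl t ∉ L.map (leftPlace (n := a + b) rfl) := by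
      rw [mem_map]; rintro ⟨u, -, hu⟩; exact leftPlace_ne_rightPlace rfl u t hu
    rw [Fin.append_right, h1]
    simp only [indWord, mem_union, mem_map', h2, false_or]

theorem tensor_smul_sum {a b n : ℕ} (h : a + b = n) {ι : Type*} (u : Qubits a) (c : ℂ) (S : Finset ι)
    (v : ι → Qubits b) : tensor h u (c • ∑ i ∈ S, v i) = c • ∑ i ∈ S, tensor h u (v i) := by
  ext w
  simp only [tensor, PiLp.smul_apply, WithLp.ofLp_sum, Finset.sum_apply, smul_eq_mul, mul_sum]
  exact sum_congr rfl fun i _ => by ring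

theorem dicke_eq (a b : ℕ) : dicke a b = (((Real.sqrt (a.choose b))⁻¹ : ℝ) : ℂ) •
    ∑ C ∈ powersetCard b (univ : Finset (Fin a)), ket (indWord C) := by
  rw [dicke]
  congr 1
  symm
  refine sum_equiv (wordEquiv a) (fun C => ?_) fun C _ => rfl
  have : (univ.filter fun t => indWord C t = 1) = C := wordEquiv_symm_indWord C
  simp [wordEquiv, this]


theorem Xi_eq {n m k l : ℕ} (h : Admissible n m k l) :
    Xi h = (((Real.sqrt ((n - k).choose (m - l)))⁻¹ : ℝ) : ℂ) •
      ∑ C ∈ powersetCard (m - l) (univ : Finset (Fin (n - k))),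
        ket (indWord ((univ.filter fun i : Fin k => (i : ℕ) < l).map
          (leftPlace (Nat.add_sub_of_le h.k_le)) ∪ C.map (rightPlace (Nat.add_sub_of_le h.k_le)))) := by
  have ho : onesZeros k l = ket (indWord (univ.filter fun i : Fin k => (i : ℕ) < l)) := by
    rw [onesZeros]
    congr 1
    funext i
    simp [indWord]
  rw [Xi, ho, dicke_eq, tensor_smul_sum]
  simp only [tensor_ket_indWord]

theorem pmf_eq_sum {n m k l x : ℕ} (h : Admissible n m k l) (hxm : x ≤ m) (hmn : m ≤ n - m) :
    pmf h x = ((n.choose x : ℂ) / (n.choose m : ℂ)) *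
      (((n : ℂ) - 2 * x + 1) / ((n : ℂ) - x + 1)) *
      ∑ t ∈ range (x + 1), (-1) ^ t * hahnCoeff n m x t *
        (((m - l).choose t : ℂ) * ((n - k - t).choose (m - l) : ℂ)) := by
  have hl := h.l_le_m
  have hk := h.k_le
  have hlk := h.l_le_k
  have hadd := h.add_le
  set P := powersetCard (m - l) (univ : Finset (Fin (n - k))) with hP
  set W : Finset (Fin (n - k)) → Finset (Fin n) := fun C =>
    (univ.filter fun i : Fin k => (i : ℕ) < l).map (leftPlace (Nat.add_sub_of_le h.k_le)) ∪
      C.map (rightPlace (Nat.add_sub_of_le h.k_le)) with hW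
  have hWcard : ∀ C ∈ P, #(W C) = m := by
    intro C hC
    rw [hW, card_union_of_disjoint (disjoint_map_places _ _ _), card_map, card_map,
      (mem_powersetCard.1 hC).2, Fin.card_filter_val_lt]
    omega
  have hWsdiff : ∀ C C', #(W C \ W C') = #(C \ C') := by
    intro C C'
    have : W C \ W C' = (C \ C').map (rightPlace (Nat.add_sub_of_le h.k_le)) := by
      rw [hW, Finset.map_sdiff, union_sdiff_distrib, sdiff_eq_empty_iff_subset.2 subset_union_left,
        empty_union, sdiff_union_distrib,
        sdiff_eq_self_of_disjoint (disjoint_map_places _ _ _).symm, inter_eq_right.2 sdiff_subset]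
    rw [this, card_map]
  set c : ℂ := ((n.choose x : ℂ) / (n.choose m : ℂ)) *
      (((n : ℂ) - 2 * x + 1) / ((n : ℂ) - x + 1)) with hc
  set H : ℂ := ∑ t ∈ range (x + 1), (-1) ^ t * hahnCoeff n m x t *
        (((m - l).choose t : ℂ) * ((n - k - t).choose (m - l) : ℂ)) with hH
  have hrow : ∀ C ∈ P, ∑ C' ∈ P, projEntry n x (W C) (W C') = c * H := by
    intro C hC
    have := sum_mul_hahn (n := n) (fun _ => (1 : ℂ)) C m (m - l) x
    rw [hH, sum_congr rfl fun C' hC' => by rw [projEntry_eq hxm hmn (hWcard C hC) (hWcard C' hC'),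
      hWsdiff], ← mul_sum]
    congr 1
    simp only [one_mul] at this
    rw [hP, this]
    refine sum_congr rfl fun t _ => ?_
    congr 1
    rw [sum_congr rfl (g := fun _ => ((n - k - t).choose (m - l) : ℂ)), sum_const, nsmul_eq_mul,
      card_powersetCard, (mem_powersetCard.1 hC).2]
    intro T hT
    rw [sum_const, nsmul_one, card_powersetCard, card_compl, Fintype.card_fin,
      (mem_powersetCard.1 hT).2]
  have hpos : (0 : ℝ) < (n - k).choose (m - l) := by
    exact_mod_cast Nat.choose_pos (show m - l ≤ n - k by omega)
  have hexp : pmf h x = ((((Real.sqrt ((n - k).choose (m - l)))⁻¹ : ℝ) : ℂ) *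
      (((Real.sqrt ((n - k).choose (m - l)))⁻¹ : ℝ) : ℂ)) *
      ∑ C ∈ P, ∑ C' ∈ P, projEntry n x (W C) (W C') := by
    rw [pmf, Xi_eq, map_smul, inner_smul_left, inner_smul_right, Complex.conj_ofReal, sum_inner,
      mul_assoc]
    congr 2
    refine sum_congr rfl fun C _ => ?_
    rw [inner_ket, map_sum, WithLp.ofLp_sum, Finset.sum_apply]
    rfl
  have hcard : (#P : ℂ) = ((n - k).choose (m - l) : ℂ) := by
    rw [hP, card_powersetCard, card_fin]
  rw [hexp, sum_congr rfl hrow, sum_const, nsmul_eq_mul, hcard, ← Complex.ofReal_mul, ← mul_inv,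
    Real.mul_self_sqrt hpos.le, ← mul_assoc]
  push_cast
  rw [inv_mul_cancel₀ (by exact_mod_cast hpos.ne'), one_mul]

theorem hypergeometric_eq_racah {n m k x M N : ℕ} (h : M + N + k = n) :
    hypergeometric [-(x : ℂ), x - n - 1, -(M : ℂ), -(N : ℂ)] [-(m : ℂ), m - n, -(M : ℂ) - N] 1 =
      racah x M (-(m : ℂ) - 1) (-(n : ℂ) + m - 1) (-(n : ℂ) + k - 1) 0 := by
  subst h
  rw [racah]
  push_cast
  congr 1
  · congr 1; congr 1
    · ring
    · congr 2; ring
  · congr 1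
    · ring
    · congr 1
      · ring
      · congr 1; ring

end RacahPmf

theorem theorem4p6 (n m k l x M N : ℕ) (h : Admissible n m k l)
    (hM : (M : ℤ) = m - l) (hN : (N : ℤ) = n - m - k + l)
    (hmn : m ≤ n - m) (hx : x ≤ m) :
    -- the presentation of the probability mass function by one terminating series
    (Terminating [-(x : ℂ), x - n - 1, -(M : ℂ), -(N : ℂ)] [-(m : ℂ), m - n, -(M : ℂ) - N] ∧
      pmf h x =
        ((n - k).choose (m - l) : ℂ) * ((n.choose x : ℂ) / (n.choose m : ℂ)) *
          (((n : ℂ) - 2 * x + 1) / ((n : ℂ) - x + 1)) *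
          hypergeometric [-(x : ℂ), x - n - 1, -(M : ℂ), -(N : ℂ)]
            [-(m : ℂ), m - n, -(M : ℂ) - N] 1) ∧
    -- that series is a Racah polynomial
    hypergeometric [-(x : ℂ), x - n - 1, -(M : ℂ), -(N : ℂ)] [-(m : ℂ), m - n, -(M : ℂ) - N] 1 =
      racah x M (-(m : ℂ) - 1) (-(n : ℂ) + m - 1) (-(n : ℂ) + k - 1) 0 ∧
    -- the equivalent hypergeometric identity
    ((∀ i ∈ Finset.range (min M N + 1),
        Terminating [-(i : ℂ), -(x : ℂ), x - n - 1] [-(m : ℂ), m - n]) ∧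
      ∑ i ∈ Finset.range (min M N + 1), (M.choose i : ℂ) * (N.choose i : ℂ) *
          hypergeometric [-(i : ℂ), -(x : ℂ), x - n - 1] [-(m : ℂ), m - n] 1 =
        ((n - k).choose (m - l) : ℂ) *
          hypergeometric [-(x : ℂ), x - n - 1, -(M : ℂ), -(N : ℂ)]
            [-(m : ℂ), m - n, -(M : ℂ) - N] 1) := by
  have hl := h.l_le_m
  have hk := h.k_le
  have hlk := h.l_le_k
  have hadd := h.add_le
  have hM' : m - l = M := by omega
  have hMN : n - k = M + N := by omega
  have h43 := choose_mul_hypergeometric_four_three n m x M N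
  refine ⟨⟨terminating_four_three M N hx hmn, ?_⟩, hypergeometric_eq_racah (by omega),
    fun i _ => terminating_three_two i hx hmn, ?_⟩
  · rw [pmf_eq_sum h hx hmn, hM', hMN, ← h43]; ring
  · simp only [hypergeometric_three_two]
    rw [sum_choose_mul_hahn, hM', hMN, h43]
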